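/- Let $B$ be a Noetherian integrally closed domain of characteristic zero (for example an excellent normal domain), and let $A\supseteq B$ be an integrally closed domain that is finite as a $B$-module. Write $F=\operatorname{Frac}A$ and $M=\operatorname{Frac}B$. Assume that $A/B$ is a local complete intersection: for every maximal ideal $\mathfrak m$ of $A$ there are $k,r\ge 0$, a prime ideal $\mathfrak n$ of $B[T_1,\dots,T_k]$ and $f_1,\dots,f_r\in\mathfrak n$ forming a regular sequence in $B[T_1,\dots,T_k]_{\mathfrak n}$, together with an isomorphism of $B$-algebras $A_{\mathfrak m}\cong B[T_1,\dots,T_k]_{\mathfrak n}/\langle f_1,\dots,f_r\rangle$. Then the codifferent $$\mathfrak C(A/B)=\{x\in F:\operatorname{Tr}_{F/M}(xA)\subseteq B\}$$ is an invertible $A$-module. More precisely, let $\mathfrak m$ be a maximal ideal of $A$. Then such a presentation of $A_{\mathfrak m}$ exists with $r=k$; and for every $k\ge 0$ and every presentation $A_{\mathfrak m}\cong B[T_1,\dots,T_k]_{\mathfrak n}/\langle f_1,\dots,f_k\rangle$ as above with $r=k$, the image $J_{\mathfrak m}\in A_{\mathfrak m}$ of $\det(\partial f_i/\partial T_j)_{i,j}$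 is nonzero and $$\mathfrak C(A/B)_{\mathfrak m}=J_{\mathfrak m}^{-1}A_{\mathfrak m}$$ as $A_{\mathfrak m}$-submodules of $F$. -/

import Mathlib

/-- A presentation of the local ring `A_𝔪` of a `B`-algebra `A` at a prime `𝔪` as
`B[T_1, …, T_k]_𝔫 / ⟨f_1, …, f_r⟩`, where `𝔫` is a prime of `B[T_1, …, T_k]` and the
polynomials `f_1, …, f_r ∈ 𝔫` form a regular sequence in the local ring `B[T_1, …, T_k]_𝔫`.
The identification is recorded as a surjective `B`-algebra homomorphism
`B[T_1, …, T_k]_𝔫 → A_𝔪` with kernel `⟨f_1, …, f_r⟩`. It is automatically local, so `𝔫` lies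
over `𝔪 ∩ B`; if `A` is finite over `B` and `𝔪` is maximal, then `𝔫` is maximal. -/
structure LocalCIPresentation (B : Type*) {A : Type*} [CommRing B] [CommRing A] [Algebra B A]
    (𝔪 : Ideal A) [𝔪.IsPrime] (k r : ℕ) where
  /-- The prime `𝔫` of the polynomial ring. -/
  𝔫 : Ideal (MvPolynomial (Fin k) B)
  isPrime : 𝔫.IsPrime
  /-- The equations. -/
  f : Fin r → MvPolynomial (Fin k) B
  f_mem : ∀ i, f i ∈ 𝔫
  isRegular : RingTheory.Sequence.IsRegular (Localization.AtPrime 𝔫)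
    (List.ofFn fun i => algebraMap (MvPolynomial (Fin k) B) (Localization.AtPrime 𝔫) (f i))
  /-- The quotient map `B[T_1, …, T_k]_𝔫 → A_𝔪`. -/
  φ : Localization.AtPrime 𝔫 →ₐ[B] Localization.AtPrime 𝔪
  surjective : Function.Surjective φ
  ker_eq : RingHom.ker φ = Ideal.span (Set.range fun i =>
    algebraMap (MvPolynomial (Fin k) B) (Localization.AtPrime 𝔫) (f i))

/-- A (finite type) algebra `A` over a Noetherian ring `B` is a local complete intersection if
each of its local rings at maximal ideals is the quotient of a localization of some polynomial
ring `B[T_1, …, T_k]` at a prime by a regular sequence. -/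
def IsLocalCompleteIntersection (B A : Type*) [CommRing B] [CommRing A] [Algebra B A] : Prop :=
  ∀ (𝔪 : Ideal A) [𝔪.IsMaximal], ∃ k r : ℕ, Nonempty (LocalCIPresentation B 𝔪 k r)

/-- The image `J_𝔪` in `A_𝔪` of the Jacobian determinant `det (∂f_i/∂T_j)` of a presentation
with as many equations as variables. -/
noncomputable def LocalCIPresentation.jacobianDet {B A : Type*} [CommRing B] [CommRing A]
    [Algebra B A] {𝔪 : Ideal A} [𝔪.IsPrime] {k : ℕ} (P : LocalCIPresentation B 𝔪 k k) :
    Localization.AtPrime 𝔪 :=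
  haveI := P.isPrime
  P.φ (algebraMap (MvPolynomial (Fin k) B) (Localization.AtPrime P.𝔫)
    (Matrix.det (Matrix.of fun i j => MvPolynomial.pderiv j (P.f i))))

/-- The codifferent `{x ∈ F : Tr_{F/M}(xA) ⊆ B}`, as an `A`-submodule of `F`. -/
noncomputable def codifferent (B A M F : Type*) [CommRing B] [CommRing A] [Field M] [Field F]
    [Algebra B A] [Algebra B M] [Algebra A F] [Algebra M F] [Algebra B F]
    [IsScalarTower B A F] [IsScalarTower B M F] : Submodule A F :=
  Submodule.traceDual B M (1 : Submodule A F)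

theorem mem_codifferent_iff {B A M F : Type*} [CommRing B] [CommRing A] [Field M] [Field F]
    [Algebra B A] [Algebra B M] [Algebra A F] [Algebra M F] [Algebra B F]
    [IsScalarTower B A F] [IsScalarTower B M F] (x : F) :
    x ∈ codifferent B A M F ↔
      ∀ a : A, Algebra.trace M F (x * algebraMap A F a) ∈ (algebraMap B M).range := by
  simp only [codifferent, Submodule.mem_traceDual, Submodule.mem_one, Algebra.traceForm_apply]
  exact ⟨fun h a => h _ ⟨a, rfl⟩, by rintro h _ ⟨a, rfl⟩; exact h a⟩

/-- The canonical embedding of the local ring `A_𝔪` of a domain `A` in the fraction field `F`. -/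
noncomputable def localRingToFrac {A : Type*} (F : Type*) [CommRing A] [IsDomain A] [Field F]
    [Algebra A F] [IsFractionRing A F] (𝔪 : Ideal A) [𝔪.IsPrime] :
    Localization.AtPrime 𝔪 →ₐ[A] F :=
  Localization.mapToFractionRing F 𝔪.primeCompl (Localization.AtPrime 𝔪)
    𝔪.primeCompl_le_nonZeroDivisors

/-! Write `x` for the images of the variables in `A_𝔪`, and `f_i = ∑ c_ij (T_j - x_j)` with `c_ij ∈
A_𝔪[T]`, so that `det c` takes the value `J` at `x`. In `F ⊗_M F` the element obtained from `det c`
is annihilated by the kernel of multiplication, which gives Tate's formula `∑_α d_α Tr(y x^α) = J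
y`, where `d_α` are the coefficients of `det c` (`trace_det_eq`). For `y` in the codifferent `ℭ` it
shows `J y ∈ A_𝔪`.

Conversely, suppose `(ℭ : J⁻¹) ⊆ 𝔪`, and take a minimal prime `q ⊆ 𝔪` of this colon ideal. It is
associated, `q = (ℭ : x')`, and its contraction to `B` has the form `(B : β)`. Since `B` is normal,
its localization there is a principal ideal ring, and `A` becomes free. If every `J y` with `y ∈ ℭ`
vanished at `q`, Tate's formula on the dual basis would make `det c` vanish in the completed fibre
`κ(q)[[X]]/(f)`. But this fibre is a complete intersection in which all variables are nilpotent, and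
there `det c ≠ 0` (`det_notMem_span_of_X_pow_mem`). So some `J y` is nonzero at `q`, which puts an
element outside `q` into `(ℭ : J⁻¹)`, a contradiction.

The equality `r = k` combines the Jacobian criterion for the separable extension `F/M`
(`card_vars_le`) with a height bound for regular sequences (`card_eqs_le`). -/

/-! ### Determinants modulo a power series complete intersection -/

namespace MvPowerSeries

variable {σ R : Type*} [CommRing R]

/-- The power series without monomials whose exponents at all `l ∈ s` are less than `m`: the
ideal generated by the `m`-th powers of the variables in `s`. -/
def powIdeal (s : Set σ) (m : ℕ) : Ideal (MvPowerSeries σ R) where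
  carrier := {h | ∀ α : σ →₀ ℕ, (∀ l ∈ s, α l < m) → coeff α h = 0}
  add_mem' := fun ha hb α hα => by rw [map_add, ha α hα, hb α hα, add_zero]
  zero_mem' := fun α _ => map_zero _
  smul_mem' := fun g h hh α hα => by
    classical
    rw [smul_eq_mul, coeff_mul]
    refine Finset.sum_eq_zero fun p hp => ?_
    have hp' : p.1 + p.2 = α := Finset.HasAntidiagonal.mem_antidiagonal.mp hp
    rw [hh p.2 fun l hl => lt_of_le_of_lt ?_ (hα l hl), mul_zero]
    rw [← hp']
    simp

theorem powIdeal_mono {s t : Set σ} (h : s ⊆ t) (m : ℕ) :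
    powIdeal (R := R) s m ≤ powIdeal t m := fun _ hg α hα => hg α fun l hl => hα l (h hl)

theorem X_pow_mem_powIdeal {s : Set σ} {l : σ} (hl : l ∈ s) (m : ℕ) :
    (X l : MvPowerSeries σ R) ^ m ∈ powIdeal s m := by
  classical
  intro α hα
  rw [coeff_X_pow, if_neg]
  rintro rfl
  simpa using hα l hl

theorem mem_powIdeal_of_X_mul_mem {s : Set σ} {l : σ} (hl : l ∉ s) {m : ℕ}
    {h : MvPowerSeries σ R} (hh : X l * h ∈ powIdeal s m) : h ∈ powIdeal s m := by
  classical
  intro α hα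
  have := hh (Finsupp.single l 1 + α) fun i hi => by
    have hne : l ≠ i := fun e => hl (e ▸ hi)
    simpa [hne] using hα i hi
  rwa [X, coeff_add_monomial_mul, one_mul] at this

variable [Fintype σ] [DecidableEq σ]

/-- By Cramer's rule `X i * E.det` is a combination of the `X l ^ m` with `l ≠ i`, and `X i` can be
cancelled modulo these powers. -/
theorem det_mem_powIdeal {E : Matrix σ σ (MvPowerSeries σ R)} {m : ℕ} {i : σ}
    (hi : E.mulVec X i = 0) (hE : ∀ l ≠ i, E.mulVec X l = X l ^ m) :
    E.det ∈ powIdeal Set.univ m := by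
  refine powIdeal_mono (Set.subset_univ {i}ᶜ) m (mem_powIdeal_of_X_mul_mem (l := i) (by simp) ?_)
  have h : E.adjugate.mulVec (E.mulVec X) i = E.det * X i := by
    rw [Matrix.mulVec_mulVec, Matrix.adjugate_mul, Matrix.smul_mulVec, Matrix.one_mulVec]
    rfl
  rw [mul_comm, ← h]
  refine Ideal.sum_mem _ fun l _ => Ideal.mul_mem_left _ _ ?_
  by_cases hl : l = i
  · rw [hl, hi]
    exact Ideal.zero_mem _
  · rw [hE l hl]
    exact X_pow_mem_powIdeal (by simpa using hl) m

/-- The determinant of a matrix that takes the vector of variables to the vector of their `m+1`-st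
powers is not in the ideal generated by these powers. -/
theorem det_notMem_powIdeal [Nontrivial R] {E : Matrix σ σ (MvPowerSeries σ R)} {m : ℕ}
    (hE : ∀ i, E.mulVec X i = X i ^ (m + 1)) : E.det ∉ powIdeal Set.univ (m + 1) := by
  let D : Matrix σ σ (MvPowerSeries σ R) := Matrix.diagonal fun i => X i ^ m
  have hD : ∀ i, D.mulVec X i = X i ^ (m + 1) := fun i => by
    rw [Matrix.mulVec_diagonal, pow_succ]
  -- Modulo the powers, the determinant depends only on the image of the vector of variables. The
  -- rows of `E` are exchanged for those of `D` one at a time; each difference of rows kills that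
  -- vector, so `det_mem_powIdeal` applies.
  have key : ∀ s : Finset σ, (Matrix.of fun i => if i ∈ s then D i else E i).det - E.det ∈
      powIdeal Set.univ (m + 1) := by
    intro s
    induction s using Finset.induction_on with
    | empty =>
      have : (Matrix.of fun i => if i ∈ (∅ : Finset σ) then D i else E i) = E := by
        ext1 i; simp
      rw [this, sub_self]
      exact Ideal.zero_mem _
    | insert i s his ih =>
      set G : Matrix σ σ (MvPowerSeries σ R) := Matrix.of fun i => if i ∈ s then D i else E i
        with hG
      have hGX : ∀ l, G.mulVec X l = X l ^ (m + 1) := fun l => by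
        by_cases hl : l ∈ s
        · rw [← hD l]; simp [Matrix.mulVec, hG, hl]
        · rw [← hE l]; simp [Matrix.mulVec, hG, hl]
      have h1 : (Matrix.of fun l => if l ∈ insert i s then D l else E l) = G.updateRow i (D i) := by
        ext l j
        by_cases hl : l = i
        · subst hl; simp
        · simp [hl, hG]
      have h2 : (G.updateRow i (D i)).det = (G.updateRow i (D i - G i)).det + G.det := by
        conv_lhs => rw [← sub_add_cancel (D i) (G i), Matrix.det_updateRow_add,
          Matrix.updateRow_eq_self]
      rw [h1, h2, add_sub_assoc]
      refine Ideal.add_mem _ (det_mem_powIdeal (i := i) ?_ fun l hl => ?_) ih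
      · have : (G.updateRow i (D i - G i)).mulVec X i = D.mulVec X i - G.mulVec X i := by
          simp [Matrix.mulVec, dotProduct, sub_mul, Finset.sum_sub_distrib]
        rw [this, hD, hGX, sub_self]
      · rw [← hGX l]
        simp [Matrix.mulVec, hl]
  intro hmem
  have h := key Finset.univ
  rw [← Ideal.add_mem_iff_left _ hmem, sub_add_cancel] at h
  have hdiag : (Matrix.of fun i => if i ∈ (Finset.univ : Finset σ) then D i else E i) = D := by
    ext1 i; simp
  rw [hdiag, Matrix.det_diagonal] at h
  -- All exponents of `det D` equal `m < m + 1`, so this monomial lies outside the ideal.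
  have hprod : ∏ i, (X i : MvPowerSeries σ R) ^ m = monomial (∑ i, Finsupp.single i m) 1 := by
    simp_rw [X_pow_eq]
    rw [MvPowerSeries.prod_monomial, Finset.prod_const_one]
  rw [hprod] at h
  have := h (∑ i, Finsupp.single i m) fun l _ => by
    simp [Finsupp.single_apply]
  rw [coeff_monomial_same] at this
  exact one_ne_zero this

/-- Let `f` be linear combinations of the variables that generate an ideal containing powers of
all variables. Then the determinant of the coefficients is not in this ideal. -/
theorem det_notMem_span_of_X_pow_mem [Nontrivial R] {c : Matrix σ σ (MvPowerSeries σ R)}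
    {f : σ → MvPowerSeries σ R} (hf : c.mulVec X = f) {m : ℕ}
    (hm : ∀ i, (X i : MvPowerSeries σ R) ^ (m + 1) ∈ Ideal.span (Set.range f)) :
    c.det ∉ Ideal.span (Set.range f) := by
  intro hdet
  choose b hb using fun i => Ideal.mem_span_range_iff_exists_fun.mp (hm i)
  have hbf : ∀ i, (Matrix.of b).mulVec f i = X i ^ (m + 1) := hb
  -- `b c` takes the variables to their powers. If `det c` were in `(f)`, Cramer's rule for `b`
  -- would put `det b * det c` into the ideal of these powers.
  refine det_notMem_powIdeal (E := Matrix.of b * c) (m := m) (fun i => ?_) ?_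
  · rw [← Matrix.mulVec_mulVec, hf, hbf]
  obtain ⟨a, ha⟩ := Ideal.mem_span_range_iff_exists_fun.mp hdet
  rw [Matrix.det_mul, ← ha, Finset.mul_sum]
  refine Ideal.sum_mem _ fun j _ => ?_
  have h : (Matrix.of b).adjugate.mulVec ((Matrix.of b).mulVec f) j = (Matrix.of b).det * f j := by
    rw [Matrix.mulVec_mulVec, Matrix.adjugate_mul, Matrix.smul_mulVec, Matrix.one_mulVec]
    rfl
  rw [mul_left_comm, ← h]
  refine Ideal.mul_mem_left _ _ (Ideal.sum_mem _ fun l _ => Ideal.mul_mem_left _ _ ?_)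
  rw [hbf]
  exact X_pow_mem_powIdeal (Set.mem_univ l) _

end MvPowerSeries

/-! ### Traces and elements of `L ⊗[K] L` -/

open scoped TensorProduct

section TraceTensor

variable {K L : Type*} [Field K] [Field L] [Algebra K L]

/-- The `L`-linear map `L ⊗[K] L → L`, `a ⊗ b ↦ a Tr(yb)`. -/
noncomputable def traceRight (K : Type*) {L : Type*} [Field K] [Field L] [Algebra K L] (y : L) :
    L ⊗[K] L →ₗ[L] L :=
  (TensorProduct.AlgebraTensorModule.rid K L L).toLinearMap ∘ₗ
    LinearMap.baseChange L (Algebra.traceForm K L y)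

@[simp]
theorem traceRight_tmul (y a b : L) :
    traceRight K y (a ⊗ₜ b) = a * algebraMap K L (Algebra.trace K L (y * b)) := by
  simp [traceRight, Algebra.traceForm_apply, Algebra.smul_def, mul_comm]

theorem traceRight_mul_one_tmul (y w : L) (z : L ⊗[K] L) :
    traceRight K y (z * (1 ⊗ₜ w)) = traceRight K (y * w) z := by
  induction z with
  | zero => simp
  | add a b ha hb => rw [add_mul, map_add, map_add, ha, hb]
  | tmul a b => simp [mul_assoc, mul_comm w]

theorem traceRight_mul_tmul_one (y w : L) (z : L ⊗[K] L) :
    traceRight K y (z * (w ⊗ₜ 1)) = w * traceRight K y z := by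
  induction z with
  | zero => simp
  | add a b ha hb => rw [add_mul, map_add, map_add, ha, hb, mul_add]
  | tmul a b => simp [mul_assoc, mul_left_comm]

variable [FiniteDimensional K L] [Algebra.IsSeparable K L] {ι : Type*} [Fintype ι] [DecidableEq ι]

theorem Module.Basis.sum_trace_traceDual_mul_smul (b : Module.Basis ι K L) (y : L) :
    ∑ i, Algebra.trace K L (b.traceDual i * y) • b i = y := by
  conv_rhs => rw [← b.sum_repr y]
  refine Finset.sum_congr rfl fun i _ => ?_
  have := b.traceDual.traceDual_repr_apply y i
  rw [Module.Basis.traceDual_traceDual, Algebra.traceForm_apply, mul_comm] at this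
  rw [this]

/-- Both sides have the same trace pairing with every `y`: the diagonal entries of multiplication by
`y` in the basis `b` are `Tr(b_i* b_i y)`. Nondegeneracy of the trace form concludes. -/
theorem Module.Basis.sum_traceDual_mul_self (b : Module.Basis ι K L) :
    ∑ i, b.traceDual i * b i = 1 := by
  refine LinearMap.BilinForm.Nondegenerate.ker_eq_bot (traceForm_nondegenerate K L) |>
    LinearMap.ker_eq_bot.mp <| ?_
  ext y
  rw [Algebra.traceForm_apply, Algebra.traceForm_apply, one_mul, Finset.sum_mul, map_sum,
    Algebra.trace_eq_matrix_trace b y, Matrix.trace]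
  refine Finset.sum_congr rfl fun i _ => ?_
  have h := b.traceDual.traceDual_repr_apply (y * b i) i
  rw [Module.Basis.traceDual_traceDual, Algebra.traceForm_apply] at h
  rw [Matrix.diag_apply, Algebra.leftMulMatrix_eq_repr_mul, h, mul_assoc, mul_comm, mul_comm y]

theorem sum_traceRight_traceDual (b : Module.Basis ι K L) (z : L ⊗[K] L) :
    ∑ i, traceRight K (b.traceDual i) z ⊗ₜ[K] b i = z := by
  induction z with
  | zero => simp
  | add x y hx hy => simp_rw [map_add, TensorProduct.add_tmul, Finset.sum_add_distrib, hx, hy]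
  | tmul x y =>
    conv_rhs => rw [← b.sum_trace_traceDual_mul_smul y, TensorProduct.tmul_sum]
    refine Finset.sum_congr rfl fun i _ => ?_
    rw [traceRight_tmul, mul_comm, ← Algebra.smul_def, TensorProduct.smul_tmul]

/-- An element of `L ⊗[K] L` annihilated by the kernel of the multiplication acts on `L` by
multiplication. -/
theorem traceRight_eq_of_mul_tmul_eq {z : L ⊗[K] L}
    (hz : ∀ w : L, z * (1 ⊗ₜ w) = z * (w ⊗ₜ 1)) (y : L) :
    traceRight K y z = LinearMap.mul' K L z * y := by
  have h : ∀ y, traceRight K y z = y * traceRight K 1 z := fun y => by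
    rw [← traceRight_mul_tmul_one, ← hz, traceRight_mul_one_tmul, one_mul]
  classical
  let b := Module.finBasis K L
  -- Expand `z` along `b` in the second factor and use `∑ b_i* b_i = 1`.
  have h1 : LinearMap.mul' K L z = traceRight K 1 z := by
    conv_lhs => rw [← sum_traceRight_traceDual b z]
    rw [map_sum]
    simp_rw [LinearMap.mul'_apply, h (b.traceDual _), mul_right_comm _ (traceRight K 1 z)]
    rw [← Finset.sum_mul, b.sum_traceDual_mul_self, one_mul]
  rw [h, h1, mul_comm]

end TraceTensor

/-! ### Tate's trace formula -/

section Divided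

theorem MvPolynomial.sub_C_eval_mem {σ O : Type*} [CommRing O] (x : σ → O) (p : MvPolynomial σ O) :
    p - C (eval x p) ∈ Ideal.span (Set.range fun j => X j - C (x j)) := by
  rw [← Ideal.Quotient.eq]
  have : (Ideal.Quotient.mkₐ O (Ideal.span (Set.range fun j => X j - C (x j)))) =
      (Algebra.ofId O _).comp (aeval x : MvPolynomial σ O →ₐ[O] O) := by
    ext j
    simp only [Ideal.Quotient.mkₐ_eq_mk, AlgHom.comp_apply, aeval_X, Algebra.ofId_apply]
    exact Ideal.Quotient.eq.mpr (Ideal.subset_span ⟨j, rfl⟩)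
  have h := DFunLike.congr_fun this p
  simp only [Ideal.Quotient.mkₐ_eq_mk, AlgHom.comp_apply, Algebra.ofId_apply] at h
  exact h

variable {σ : Type*} [Fintype σ]

/-- Polynomials that vanish at `x` are combinations of the `T_j - x_j`, and the coefficients take
the values of the partial derivatives at `x`. -/
theorem MvPolynomial.exists_eq_sum_mul_X_sub_C {O ι : Type*} [CommRing O] (x : σ → O)
    (f : ι → MvPolynomial σ O) (hf : ∀ i, eval x (f i) = 0) :
    ∃ c : ι → σ → MvPolynomial σ O, (∀ i, f i = ∑ j, c i j * (X j - C (x j))) ∧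
      ∀ i j, eval x (c i j) = eval x (pderiv j (f i)) := by
  classical
  have h : ∀ i, ∃ c : σ → MvPolynomial σ O, ∑ j, c j * (X j - C (x j)) = f i := fun i => by
    have := sub_C_eval_mem x (f i)
    rw [hf, C_0, sub_zero] at this
    exact Ideal.mem_span_range_iff_exists_fun.mp this
  choose c hc using h
  refine ⟨c, fun i => (hc i).symm, fun i l => ?_⟩
  rw [← hc i]
  simp [pderiv_X, Pi.single_apply, Derivation.leibniz, apply_ite (eval x)]

variable {K L : Type*} [Field K] [Field L] [Algebra K L] [FiniteDimensional K L]
  [Algebra.IsSeparable K L] [DecidableEq σ]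

open MvPolynomial in
/-- Tate's trace formula: if `f_i(T) = ∑ c_ij (T_j - x_j)`, then `det c` represents multiplication
by its value at `x`. -/
theorem trace_det_eq {x : σ → L} (hx : Algebra.adjoin K (Set.range x) = ⊤)
    {f : σ → MvPolynomial σ K} (hf : ∀ i, aeval x (f i) = 0)
    {c : Matrix σ σ (MvPolynomial σ L)}
    (hc : ∀ i, map (algebraMap K L) (f i) = ∑ j, c i j * (X j - C (x j))) (y : L) :
    ∑ α ∈ c.det.support, coeff α c.det *
      algebraMap K L (Algebra.trace K L (y * α.prod fun j n => x j ^ n)) = eval x c.det * y := by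
  -- Coefficients go to the left factor and variables to the right one, so `T_j - x_j` becomes `1 ⊗
  -- x_j - x_j ⊗ 1` and `f_i` becomes zero. Cramer's rule then shows that `ev c.det` annihilates
  -- these differences.
  let ev : MvPolynomial σ L →ₐ[L] L ⊗[K] L := aeval fun j => 1 ⊗ₜ x j
  let incl : L →ₐ[K] L ⊗[K] L := Algebra.TensorProduct.includeRight
  have hevf : ∀ i, ev (map (algebraMap K L) (f i)) = 0 := fun i => by
    have h1 : ev (map (algebraMap K L) (f i)) = aeval (fun j => incl (x j)) (f i) :=
      aeval_map_algebraMap L _ (f i)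
    rw [h1, ← comp_aeval_apply, hf, map_zero]
  have hX : ∀ j, ev (X j - C (x j)) = 1 ⊗ₜ x j - x j ⊗ₜ 1 := fun j => by
    rw [map_sub, aeval_X, aeval_C]
    rfl
  have hz : ∀ j, ev c.det * (1 ⊗ₜ x j) = ev c.det * (x j ⊗ₜ 1) := fun j => by
    rw [← sub_eq_zero, ← mul_sub, ← hX, ← map_mul]
    have h : c.adjugate.mulVec (c.mulVec fun j => X j - C (x j)) j =
        c.det * (X j - C (x j)) := by
      rw [Matrix.mulVec_mulVec, Matrix.adjugate_mul, Matrix.smul_mulVec, Matrix.one_mulVec]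
      rfl
    rw [← h, Matrix.mulVec, dotProduct, map_sum]
    refine Finset.sum_eq_zero fun i _ => ?_
    rw [map_mul, show c.mulVec (fun j => X j - C (x j)) i = _ from (hc i).symm, hevf, mul_zero]
  have hz' : ∀ w : L, ev c.det * (1 ⊗ₜ w) = ev c.det * (w ⊗ₜ 1) := fun w => by
    have hw : w ∈ Algebra.adjoin K (Set.range x) := hx ▸ Algebra.mem_top
    induction hw using Algebra.adjoin_induction with
    | mem w hw => obtain ⟨j, rfl⟩ := hw; exact hz j
    | algebraMap r =>
      rw [Algebra.algebraMap_eq_smul_one, TensorProduct.smul_tmul]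
    | add a b _ _ ha hb =>
      rw [TensorProduct.tmul_add, TensorProduct.add_tmul, mul_add, mul_add, ha, hb]
    | mul a b _ _ ha hb =>
      rw [← mul_one (1 : L), ← Algebra.TensorProduct.tmul_mul_tmul, ← mul_assoc, ha,
        mul_right_comm, hb, mul_assoc, Algebra.TensorProduct.tmul_mul_tmul, mul_one,
        mul_comm b a]
  have key := traceRight_eq_of_mul_tmul_eq hz' y
  have hev : ∀ p : MvPolynomial σ L, ev p = ∑ α ∈ p.support, coeff α p ⊗ₜ
      (α.prod fun j n => x j ^ n) := fun p => by
    rw [aeval_def, eval₂_eq']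
    refine Finset.sum_congr rfl fun α _ => ?_
    rw [Finsupp.prod_fintype _ _ fun j => pow_zero _]
    simp_rw [Algebra.TensorProduct.tmul_pow, one_pow]
    rw [Algebra.TensorProduct.algebraMap_apply]
    have h := map_prod incl (fun j => x j ^ α j) Finset.univ
    simp only [incl, Algebra.TensorProduct.includeRight_apply] at h
    rw [← h]
    simp
  have hmul : LinearMap.mul' K L (ev c.det) = eval x c.det := by
    rw [hev, eval_eq, map_sum]
    rfl
  rw [← hmul, ← key, hev, map_sum]
  simp_rw [traceRight_tmul]

end Divided

/-! ### Finiteness, heights and the embedding of the local ring -/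

theorem finiteDimensional_of_isFractionRing (B A M F : Type*) [CommRing B] [IsDomain B] [CommRing A]
    [IsDomain A] [Algebra B A] [FaithfulSMul B A] [Module.Finite B A] [Field M] [Algebra B M]
    [IsFractionRing B M] [Field F] [Algebra A F] [IsFractionRing A F] [Algebra M F] [Algebra B F]
    [IsScalarTower B A F] [IsScalarTower B M F] : FiniteDimensional M F :=
  Module.Finite.of_isLocalization B A (nonZeroDivisors B)

/-- The sequence stays regular in `R_Q`, where its length plus the dimension of the nonzero quotient
is the height of `Q`. -/
theorem RingTheory.Sequence.IsWeaklyRegular.length_le_height {R : Type*} [CommRing R]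
    [IsNoetherianRing R] {rs : List R} (h : IsWeaklyRegular R rs) (Q : Ideal R) [Q.IsPrime]
    (hrs : ∀ a ∈ rs, a ∈ Q) : (rs.length : ℕ∞) ≤ Q.height := by
  have hreg := h.isRegular_of_isLocalization_of_mem (S := Localization.AtPrime Q) Q hrs
  set rs' := rs.map (algebraMap R (Localization.AtPrime Q)) with hrs'
  have h1 := ringKrullDim_add_length_eq_ringKrullDim_of_isRegular _ hreg
  have : Nontrivial (Localization.AtPrime Q ⧸ Ideal.ofList rs') :=
    Ideal.Quotient.nontrivial_iff.mpr fun h => hreg.2 <| by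
      rw [smul_eq_mul, Ideal.mul_top]
      exact h.symm
  rw [IsLocalization.AtPrime.ringKrullDim_eq_height Q (Localization.AtPrime Q)] at h1
  refine WithBot.coe_le_coe.mp ?_
  rw [← h1, hrs', List.length_map]
  exact le_add_of_nonneg_left ringKrullDim_nonneg_of_nontrivial

section LocalRing

variable {A : Type*} (F : Type*) [CommRing A] [IsDomain A] [Field F]
    [Algebra A F] [IsFractionRing A F] (𝔪 : Ideal A) [𝔪.IsPrime]

theorem localRingToFrac_injective : Function.Injective (localRingToFrac F 𝔪) := by
  rw [injective_iff_map_eq_zero]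
  intro x hx
  obtain ⟨a, s, rfl⟩ := IsLocalization.exists_mk'_eq 𝔪.primeCompl x
  rw [IsLocalization.mk'_eq_zero_iff]
  have h : localRingToFrac F 𝔪 (algebraMap A _ s.1 * IsLocalization.mk' _ a s) = 0 := by
    rw [map_mul, hx, mul_zero]
  rw [IsLocalization.mk'_spec', AlgHom.commutes,
    map_eq_zero_iff _ (IsFractionRing.injective A F)] at h
  exact ⟨1, by rw [h, mul_zero]⟩

/-- The embedding of the local ring in the fraction field as a homomorphism over a base ring. -/
noncomputable def localRingToFracOver (B : Type*) [CommRing B] [Algebra B A] [Algebra B F]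
    [IsScalarTower B A F] : Localization.AtPrime 𝔪 →ₐ[B] F :=
  (localRingToFrac F 𝔪).restrictScalars B

end LocalRing

/-! ### Presentations: generation of `F`, the Jacobian criterion, and `r = k` -/

namespace LocalCIPresentation

open MvPolynomial

variable {B A : Type*} [CommRing B] [CommRing A] [Algebra B A] {𝔪 : Ideal A} [𝔪.IsPrime] {k r : ℕ}
  (P : LocalCIPresentation B 𝔪 k r)

instance : P.𝔫.IsPrime := P.isPrime

/-- The images of the variables in the local ring. -/
noncomputable def coord (j : Fin k) : Localization.AtPrime 𝔪 :=
  P.φ (algebraMap (MvPolynomial (Fin k) B) (Localization.AtPrime P.𝔫) (X j))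

theorem φ_algebraMap (p : MvPolynomial (Fin k) B) :
    P.φ (algebraMap (MvPolynomial (Fin k) B) (Localization.AtPrime P.𝔫) p) = aeval P.coord p := by
  have : P.φ.comp (IsScalarTower.toAlgHom B (MvPolynomial (Fin k) B)
      (Localization.AtPrime P.𝔫)) = aeval P.coord := by
    ext j
    simp [coord]
  exact DFunLike.congr_fun this p

theorem aeval_coord_f (i : Fin r) : aeval P.coord (P.f i) = 0 := by
  rw [← φ_algebraMap, ← RingHom.mem_ker (f := P.φ), P.ker_eq]
  exact Ideal.subset_span ⟨i, rfl⟩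

theorem isUnit_aeval_coord {v : MvPolynomial (Fin k) B} (hv : v ∉ P.𝔫) :
    IsUnit (aeval P.coord v) := by
  rw [← φ_algebraMap]
  exact (IsLocalization.map_units (Localization.AtPrime P.𝔫)
    (⟨v, hv⟩ : P.𝔫.primeCompl)).map P.φ

theorem exists_mul_aeval_eq (y : Localization.AtPrime 𝔪) :
    ∃ g v : MvPolynomial (Fin k) B, v ∉ P.𝔫 ∧ y * aeval P.coord v = aeval P.coord g := by
  obtain ⟨z, rfl⟩ := P.surjective y
  obtain ⟨⟨g, v⟩, h⟩ := IsLocalization.surj P.𝔫.primeCompl z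
  exact ⟨g, v, v.2, by rw [← φ_algebraMap, ← φ_algebraMap, ← map_mul, h]⟩

theorem exists_mul_mem_span {h : MvPolynomial (Fin k) B} (hh : aeval P.coord h = 0) :
    ∃ u ∉ P.𝔫, u * h ∈ Ideal.span (Set.range P.f) := by
  rw [← φ_algebraMap, ← RingHom.mem_ker (f := P.φ), P.ker_eq] at hh
  have h1 : (Set.range fun i => algebraMap (MvPolynomial (Fin k) B) (Localization.AtPrime P.𝔫)
      (P.f i)) = algebraMap _ _ '' Set.range P.f := Set.range_comp _ _
  rw [h1, ← Ideal.map_span,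
    IsLocalization.algebraMap_mem_map_algebraMap_iff P.𝔫.primeCompl] at hh
  exact hh

theorem jacobianDet_eq (P : LocalCIPresentation B 𝔪 k k) : P.jacobianDet =
    aeval P.coord (Matrix.det (Matrix.of fun i j => pderiv j (P.f i))) :=
  P.φ_algebraMap _

theorem aeval_localRingToFrac [IsDomain A] {F : Type*} [Field F] [Algebra A F]
    [IsFractionRing A F] [Algebra B F] [IsScalarTower B A F] (p : MvPolynomial (Fin k) B) :
    aeval (fun j => localRingToFrac F 𝔪 (P.coord j)) p =
      localRingToFrac F 𝔪 (aeval P.coord p) :=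
  (comp_aeval_apply (f := P.coord) (localRingToFracOver F 𝔪 B) p).symm

/-- As `F/M` is algebraic, the adjoined algebra is closed under inverses. Elements of `A` are
quotients of polynomials in the coordinates, so it contains `A` and then all of `F`. -/
theorem adjoin_coord_eq_top [IsDomain B] [IsDomain A] [FaithfulSMul B A]
    [Module.Finite B A] (M F : Type*) [Field M] [Algebra B M] [IsFractionRing B M] [Field F] [Algebra A F]
    [IsFractionRing A F] [Algebra M F] [Algebra B F] [IsScalarTower B A F] [IsScalarTower B M F] :
    Algebra.adjoin M (Set.range fun j => localRingToFrac F 𝔪 (P.coord j)) = ⊤ := by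
  have := finiteDimensional_of_isFractionRing B A M F
  set S := Algebra.adjoin M (Set.range fun j => localRingToFrac F 𝔪 (P.coord j)) with hS
  have hp : ∀ p : MvPolynomial (Fin k) B, localRingToFrac F 𝔪 (aeval P.coord p) ∈ S := fun p => by
    rw [← aeval_localRingToFrac, ← aeval_map_algebraMap M, hS, Algebra.adjoin_range_eq_range_aeval]
    exact ⟨_, rfl⟩
  have hinv : ∀ y ∈ S, y⁻¹ ∈ S := fun y hy =>
    S.inv_mem_of_algebraic (x := ⟨y, hy⟩) (Algebra.IsAlgebraic.isAlgebraic y)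
  have hA : ∀ a : A, algebraMap A F a ∈ S := fun a => by
    obtain ⟨g, v, hv, h⟩ := P.exists_mul_aeval_eq (algebraMap A _ a)
    have hu := ((P.isUnit_aeval_coord hv).map (localRingToFrac F 𝔪)).ne_zero
    have := congr_arg (localRingToFrac F 𝔪) h
    rw [map_mul, AlgHom.commutes, ← eq_mul_inv_iff_mul_eq₀ hu] at this
    rw [this]
    exact mul_mem (hp g) (hinv _ (hp v))
  rw [eq_top_iff]
  rintro y -
  obtain ⟨a, b, -, rfl⟩ := IsFractionRing.div_surjective A y
  rw [div_eq_mul_inv]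
  exact mul_mem (hA a) (hinv _ (hA b))

/-- The vector `v` defines a derivation `d` of `B[T]` into `F` that kills the equations, hence
everything that vanishes at the coordinates. Applied to a relation `p(x_l) = 0`, with `p` the
minimal polynomial cleared of denominators, it gives `p'(x_l) v_l = 0`, and `p'(x_l) ≠ 0` by
separability. -/
theorem eq_zero_of_sum_pderiv_mul_eq_zero [IsDomain B] [IsDomain A] [FaithfulSMul B A]
    [Module.Finite B A] [CharZero B] (M F : Type*) [Field M] [Algebra B M] [IsFractionRing B M] [Field F] [Algebra A F]
    [IsFractionRing A F] [Algebra M F] [Algebra B F] [IsScalarTower B A F] [IsScalarTower B M F]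
    {v : Fin k → F}
    (hv : ∀ i, ∑ j, localRingToFrac F 𝔪 (aeval P.coord (pderiv j (P.f i))) * v j = 0) :
    v = 0 := by
  have := finiteDimensional_of_isFractionRing B A M F
  have : CharZero M := IsFractionRing.charZero_of_isFractionRing B
  let e : MvPolynomial (Fin k) B →ₐ[B] F := aeval fun j => localRingToFrac F 𝔪 (P.coord j)
  have he : ∀ p, e p = localRingToFrac F 𝔪 (aeval P.coord p) := P.aeval_localRingToFrac
  let d : MvPolynomial (Fin k) B → F := fun p => ∑ j, e (pderiv j p) * v j
  have dmul : ∀ p q, d (p * q) = e p * d q + e q * d p := fun p q => by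
    simp only [d, Finset.mul_sum, ← Finset.sum_add_distrib]
    refine Finset.sum_congr rfl fun j _ => ?_
    rw [pderiv_mul, map_add, map_mul, map_mul]
    ring
  have dadd : ∀ p q, d (p + q) = d p + d q := fun p q => by
    simp only [d, map_add, add_mul, Finset.sum_add_distrib]
  have df : ∀ i, d (P.f i) = 0 := fun i => by
    rw [← hv i]
    exact Finset.sum_congr rfl fun j _ => by rw [he]
  have dspan : ∀ p ∈ Ideal.span (Set.range P.f), e p = 0 ∧ d p = 0 := fun p hp => by
    induction hp using Submodule.span_induction with
    | mem p hp =>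
      obtain ⟨i, rfl⟩ := hp
      exact ⟨by rw [he, aeval_coord_f, map_zero], df i⟩
    | zero => simp [d]
    | add p q _ _ hp hq => exact ⟨by rw [map_add, hp.1, hq.1, add_zero],
        by rw [dadd, hp.2, hq.2, add_zero]⟩
    | smul a p _ hp => exact ⟨by rw [smul_eq_mul, map_mul, hp.1, mul_zero],
        by rw [smul_eq_mul, dmul, hp.1, hp.2, zero_mul, mul_zero, add_zero]⟩
  have dker : ∀ p, e p = 0 → d p = 0 := fun p hp => by
    have h0 : aeval P.coord p = 0 := localRingToFrac_injective F 𝔪 <| by rw [← he, hp, map_zero]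
    obtain ⟨u, hu, hup⟩ := P.exists_mul_mem_span h0
    have h1 := (dspan _ hup).2
    rw [dmul, hp, zero_mul, add_zero] at h1
    refine (mul_eq_zero.mp h1).resolve_left ?_
    rw [he]
    exact ((P.isUnit_aeval_coord hu).map (localRingToFrac F 𝔪)).ne_zero
  ext l
  set x := localRingToFrac F 𝔪 (P.coord l) with hx
  let p := IsLocalization.integerNormalization (nonZeroDivisors B) (minpoly M x)
  obtain ⟨b, hb, hbp⟩ := IsLocalization.integerNormalization_spec (nonZeroDivisors B) (minpoly M x)
  have hp0 : Polynomial.aeval x p = 0 :=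
    IsLocalization.integerNormalization_aeval_eq_zero _ _ (minpoly.aeval M x)
  have hp1 : Polynomial.aeval x (Polynomial.derivative p) ≠ 0 := by
    have h2 : Polynomial.aeval x (Polynomial.derivative (p.map (algebraMap B M))) ≠ 0 := by
      rw [hbp, Polynomial.derivative_smul, ← algebraMap_smul M b, map_smul, Algebra.smul_def,
        ← IsScalarTower.algebraMap_apply]
      refine mul_ne_zero ?_ (Polynomial.Separable.aeval_derivative_ne_zero
        (Algebra.IsSeparable.isSeparable M x) (minpoly.aeval M x))
      rw [IsScalarTower.algebraMap_apply B A F, Ne, map_eq_zero_iff _ (IsFractionRing.injective A F),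
        map_eq_zero_iff _ (FaithfulSMul.algebraMap_injective B A)]
      exact nonZeroDivisors.ne_zero hb
    rwa [Polynomial.derivative_map, Polynomial.aeval_map_algebraMap] at h2
  have heX : ∀ q : Polynomial B, e (Polynomial.aeval (X l) q) = Polynomial.aeval x q := fun q => by
    rw [← Polynomial.aeval_algHom_apply, aeval_X]
  have h3 := dker (Polynomial.aeval (X l) p) (by rw [heX, hp0])
  have h4 : d (Polynomial.aeval (X l) p) =
      Polynomial.aeval x (Polynomial.derivative p) * v l := by
    simp only [d]
    rw [Finset.sum_eq_single l]
    · rw [Derivation.map_aeval, smul_eq_mul, map_mul, heX, pderiv_X_self, map_one, mul_one]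
    · intro j _ hj
      rw [Derivation.map_aeval, pderiv_X_of_ne hj.symm, smul_zero, map_zero, zero_mul]
    · simp
  rw [h4] at h3
  exact (mul_eq_zero.mp h3).resolve_left hp1

theorem card_vars_le (P : LocalCIPresentation B 𝔪 k r) [IsDomain B]
    [IsDomain A] [FaithfulSMul B A]
    [Module.Finite B A] [CharZero B] (M F : Type*) [Field M] [Algebra B M] [IsFractionRing B M] [Field F] [Algebra A F]
    [IsFractionRing A F] [Algebra M F] [Algebra B F] [IsScalarTower B A F] [IsScalarTower B M F] : k ≤ r := by
  let g : (Fin k → F) →ₗ[F] (Fin r → F) := Matrix.mulVecLin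
    (Matrix.of fun i j => localRingToFrac F 𝔪 (aeval P.coord (pderiv j (P.f i))))
  have hg : Function.Injective g := by
    rw [← LinearMap.ker_eq_bot, LinearMap.ker_eq_bot']
    exact fun v hv => P.eq_zero_of_sum_pderiv_mul_eq_zero M F fun i => congr_fun hv i
  simpa using LinearMap.finrank_le_finrank_of_injective hg

theorem jacobianDet_ne_zero (P : LocalCIPresentation B 𝔪 k k)
    [IsDomain B] [IsDomain A] [FaithfulSMul B A]
    [Module.Finite B A] [CharZero B] (M F : Type*) [Field M] [Algebra B M] [IsFractionRing B M] [Field F] [Algebra A F]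
    [IsFractionRing A F] [Algebra M F] [Algebra B F] [IsScalarTower B A F] [IsScalarTower B M F] :
    localRingToFrac F 𝔪 P.jacobianDet ≠ 0 := by
  rw [jacobianDet_eq, AlgHom.map_det, AlgHom.map_det]
  intro h
  obtain ⟨v, hv0, hv⟩ := Matrix.exists_mulVec_eq_zero_iff.mpr h
  exact hv0 (P.eq_zero_of_sum_pderiv_mul_eq_zero M F fun i => congr_fun hv i)

/-- The equations lie in the kernel `Q` of `B[T]_𝔫 → F`. Localization preserves heights, so `Q` has
the height of the kernel of `M[T] → F`, which is at most `dim M[T] = k`. -/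
theorem card_eqs_le (P : LocalCIPresentation B 𝔪 k r) [IsNoetherianRing B]
    [IsDomain B] [IsDomain A] [FaithfulSMul B A]
    [Module.Finite B A] (M F : Type*) [Field M] [Algebra B M] [IsFractionRing B M] [Field F] [Algebra A F]
    [IsFractionRing A F] [Algebra M F] [Algebra B F] [IsScalarTower B A F] [IsScalarTower B M F] : r ≤ k := by
  let R := Localization.AtPrime P.𝔫
  let g : R →ₐ[B] F := (localRingToFracOver F 𝔪 B).comp P.φ
  let Q : Ideal R := RingHom.ker g
  have hQ : Q.IsPrime := RingHom.ker_isPrime _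
  have h2 := P.isRegular.toIsWeaklyRegular.length_le_height Q fun a ha => by
    obtain ⟨i, rfl⟩ := List.mem_ofFn.mp ha
    change localRingToFrac F 𝔪 (P.φ _) = 0
    rw [φ_algebraMap, aeval_coord_f, map_zero]
  let q : Ideal (MvPolynomial (Fin k) M) :=
    RingHom.ker (aeval fun j => localRingToFrac F 𝔪 (P.coord j) : _ →ₐ[M] F)
  have hq : q.IsPrime := RingHom.ker_isPrime _
  have hQq : Q.under (MvPolynomial (Fin k) B) = q.comap (map (algebraMap B M)) := by
    ext p
    change localRingToFrac F 𝔪 (P.φ _) = 0 ↔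
      aeval (fun j => localRingToFrac F 𝔪 (P.coord j)) (map (algebraMap B M) p) = 0
    rw [φ_algebraMap, aeval_map_algebraMap, aeval_localRingToFrac]
  have h4 : (q.comap (map (algebraMap B M))).height = q.height :=
    letI := algebraMvPolynomial (σ := Fin k) (R := B) (S := M)
    IsLocalization.height_under ((nonZeroDivisors B).map (C (σ := Fin k))) q
  rw [← IsLocalization.height_under P.𝔫.primeCompl Q, hQq, h4, List.length_ofFn] at h2
  have h5 := (WithBot.coe_le_coe.mpr h2).trans <| Ideal.height_le_ringKrullDim_of_ne_top hq.ne_top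
  rw [MvPolynomial.ringKrullDim_of_isNoetherianRing, ringKrullDim_eq_zero_of_field, zero_add,
    Nat.card_eq_fintype_card, Fintype.card_fin] at h5
  exact_mod_cast h5

end LocalCIPresentation

/-! ### The completed fibre at a point of the local ring -/

namespace LocalCIPresentation

open MvPolynomial

section PowerSeries

variable {B A : Type*} [CommRing B] [CommRing A] [Algebra B A] {𝔪 : Ideal A} [𝔪.IsPrime] {k r : ℕ}
  (P : LocalCIPresentation B 𝔪 k r) {κ : Type*} [Field κ] (ρ : Localization.AtPrime 𝔪 →+* κ)

/-- The Taylor expansion, at the `κ`-point given by the coordinates, of the reduction of a polynomial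
over `A_𝔪`. -/
noncomputable def taylor : MvPolynomial (Fin k) (Localization.AtPrime 𝔪) →+*
    MvPowerSeries (Fin k) κ :=
  eval₂Hom (MvPowerSeries.C.comp ρ) fun j => MvPowerSeries.X j + MvPowerSeries.C (ρ (P.coord j))

theorem constantCoeff_taylor (p : MvPolynomial (Fin k) (Localization.AtPrime 𝔪)) :
    MvPowerSeries.constantCoeff (P.taylor ρ p) = ρ (eval P.coord p) := by
  have : MvPowerSeries.constantCoeff.comp (P.taylor ρ) = ρ.comp (eval P.coord) := by
    ext <;> simp [taylor]
  exact RingHom.congr_fun this p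

/-- The reductions of the equations in the power series ring over `κ`. -/
noncomputable def eqn (i : Fin r) : MvPowerSeries (Fin k) κ :=
  P.taylor ρ (map (algebraMap B (Localization.AtPrime 𝔪)) (P.f i))

theorem isUnit_taylor_map {v : MvPolynomial (Fin k) B} (hv : v ∉ P.𝔫) :
    IsUnit (P.taylor ρ (map (algebraMap B (Localization.AtPrime 𝔪)) v)) := by
  rw [MvPowerSeries.isUnit_iff_constantCoeff, constantCoeff_taylor, eval_map, ← aeval_def]
  exact (P.isUnit_aeval_coord hv).map ρ

/-- The completed fibre of a presentation at a `κ`-point. -/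
abbrev Fibre : Type _ := MvPowerSeries (Fin k) κ ⧸ Ideal.span (Set.range (P.eqn ρ))

/-- Polynomials outside `𝔫` have Taylor expansions with nonzero constant term, so the expansion
extends to `B[T]_𝔫`; it sends the equations to zero in the fibre and so factors through `A_𝔪`. -/
theorem exists_toFibre : ∃ χ : Localization.AtPrime 𝔪 →+* P.Fibre ρ,
    (∀ b : B, χ (algebraMap B _ b) = algebraMap κ _ (ρ (algebraMap B _ b))) ∧
    ∀ j, χ (P.coord j) = Ideal.Quotient.mk _ (MvPowerSeries.X j) +
      algebraMap κ _ (ρ (P.coord j)) := by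
  let ψ : MvPolynomial (Fin k) B →+* P.Fibre ρ :=
    ((Ideal.Quotient.mk _).comp (P.taylor ρ)).comp (map (algebraMap B (Localization.AtPrime 𝔪)))
  let ψ' : Localization.AtPrime P.𝔫 →+* P.Fibre ρ :=
    IsLocalization.lift (M := P.𝔫.primeCompl) (g := ψ) fun v =>
      (P.isUnit_taylor_map ρ v.2).map (Ideal.Quotient.mk _)
  have hψ' : ∀ p, ψ' (algebraMap _ _ p) = ψ p := fun p => IsLocalization.lift_eq _ p
  have hker : RingHom.ker (P.φ : Localization.AtPrime P.𝔫 →+* Localization.AtPrime 𝔪) ≤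
      RingHom.ker ψ' := by
    change RingHom.ker P.φ ≤ _
    rw [P.ker_eq, Ideal.span_le]
    rintro _ ⟨i, rfl⟩
    rw [SetLike.mem_coe, RingHom.mem_ker, hψ']
    exact Ideal.Quotient.eq_zero_iff_mem.mpr (Ideal.subset_span ⟨i, rfl⟩)
  let χ := RingHom.liftOfSurjective (P.φ : Localization.AtPrime P.𝔫 →+* Localization.AtPrime 𝔪)
    P.surjective ⟨ψ', hker⟩
  have hχ : ∀ p, χ (P.φ (algebraMap _ _ p)) = ψ p := fun p => by
    rw [← hψ']
    exact RingHom.liftOfRightInverse_comp_apply _ _ _ ⟨ψ', hker⟩ _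
  refine ⟨χ, fun b => ?_, fun j => ?_⟩
  · have h := hχ (C b)
    rw [φ_algebraMap, aeval_C] at h
    rw [h]
    simp [ψ, taylor]
    rfl
  · refine (hχ (X j)).trans ?_
    simp [ψ, taylor]
    rfl

variable [Module.Finite B A]

/-- Finiteness of `A` over `B` makes a unit multiple `y` of each variable integral over `κ` in the
fibre. Split off the power of `T` from its equation: `y ^ n * q(y) = 0` with `q(0) ≠ 0`. Since `y`
lifts to a series without constant term, `q(y)` is a unit and `y ^ n = 0`. -/
theorem exists_X_pow_mem_span_eqn : ∃ m : ℕ, ∀ j,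
    (MvPowerSeries.X j : MvPowerSeries (Fin k) κ) ^ (m + 1) ∈ Ideal.span (Set.range (P.eqn ρ)) := by
  obtain ⟨χ, hχB, hχ⟩ := P.exists_toFibre ρ
  have h : ∀ j, ∃ m : ℕ,
      (MvPowerSeries.X j : MvPowerSeries (Fin k) κ) ^ m ∈ Ideal.span (Set.range (P.eqn ρ)) := by
    intro j
    obtain ⟨⟨a, s⟩, has⟩ := IsLocalization.surj 𝔪.primeCompl (P.coord j)
    have hint : ∀ a : A, IsIntegral κ (χ (algebraMap A _ a)) := fun a =>
      (Algebra.IsIntegral.isIntegral (R := B) a).map_of_comp_eq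
        (ρ.comp (algebraMap B _)) (χ.comp (algebraMap A _)) <| by
          ext b
          simp only [RingHom.comp_apply]
          rw [← hχB, ← IsScalarTower.algebraMap_apply]
    have hs : IsUnit (χ (algebraMap A _ s.1)) := (IsLocalization.map_units _ s).map χ
    set y := χ (algebraMap A _ s.1) * Ideal.Quotient.mk _ (MvPowerSeries.X j) with hy
    have hyint : IsIntegral κ y := by
      have h1 : y = χ (algebraMap A _ a) -
          algebraMap κ _ (ρ (P.coord j)) * χ (algebraMap A _ s.1) := by
        rw [← has, map_mul, hχ, hy]
        ring
      rw [h1]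
      exact (hint a).sub (isIntegral_algebraMap.mul (hint s.1))
    obtain ⟨p, hp, hpy⟩ := hyint
    obtain ⟨q, hq, hq0⟩ := p.exists_eq_pow_rootMultiplicity_mul_and_not_dvd hp.ne_zero 0
    rw [map_zero, sub_zero] at hq hq0
    rw [Polynomial.X_dvd_iff] at hq0
    have hqy : IsUnit (Polynomial.aeval y q) := by
      obtain ⟨g, hg⟩ := Ideal.Quotient.mk_surjective (χ (algebraMap A _ s.1))
      have h2 : y = Ideal.Quotient.mkₐ κ (Ideal.span (Set.range (P.eqn ρ))) (g * MvPowerSeries.X j) := by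
        rw [hy, ← hg, ← map_mul]; rfl
      rw [h2, Polynomial.aeval_algHom_apply]
      suffices h : IsUnit (Polynomial.aeval (g * MvPowerSeries.X j) q) from
        h.map (Ideal.Quotient.mk _)
      rw [MvPowerSeries.isUnit_iff_constantCoeff]
      refine IsUnit.mk0 _ ?_
      have h3 : MvPowerSeries.constantCoeff (Polynomial.aeval (g * MvPowerSeries.X j) q) =
          q.coeff 0 := by
        rw [Polynomial.aeval_def, Polynomial.hom_eval₂, map_mul, MvPowerSeries.constantCoeff_X,
          mul_zero, Polynomial.eval₂_at_zero]
        simp [MvPowerSeries.algebraMap_apply]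
      rwa [h3]
    refine ⟨p.rootMultiplicity 0, ?_⟩
    rw [← Ideal.Quotient.eq_zero_iff_mem, map_pow]
    have h4 : y ^ p.rootMultiplicity 0 * Polynomial.aeval y q = 0 := by
      rw [← hpy, ← Polynomial.aeval_def]
      conv_rhs => rw [hq, map_mul, map_pow, Polynomial.aeval_X]
    rw [hqy.mul_left_eq_zero, hy, mul_pow, (hs.pow _).mul_right_eq_zero] at h4
    exact h4
  choose m hm using h
  refine ⟨Finset.univ.sup m, fun j => Ideal.pow_mem_of_pow_mem _ (hm j) ?_⟩
  exact (Finset.le_sup (Finset.mem_univ j)).trans (Nat.le_succ _)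

end PowerSeries

/-! ### The Jacobian determinant and the codifferent -/

section Trace

variable {B A : Type*} [CommRing B] [IsDomain B] [CharZero B] [CommRing A] [IsDomain A]
  [Algebra B A] [FaithfulSMul B A] [Module.Finite B A] {𝔪 : Ideal A} [𝔪.IsPrime] {k : ℕ}
  (P : LocalCIPresentation B 𝔪 k k)
  (M F : Type*) [Field M] [Algebra B M] [IsFractionRing B M] [Field F] [Algebra A F]
  [IsFractionRing A F] [Algebra M F] [Algebra B F] [IsScalarTower B A F] [IsScalarTower B M F]

/-- Tate's formula for a matrix `c` chosen over `A_𝔪` rather than `F`: integrality of its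
coefficients is what bounds the codifferent and allows reduction at a point. -/
theorem exists_matrix_trace_formula :
    ∃ c : Matrix (Fin k) (Fin k) (MvPolynomial (Fin k) (Localization.AtPrime 𝔪)),
      (∀ i, map (algebraMap B _) (P.f i) = ∑ j, c i j * (X j - C (P.coord j))) ∧
      ∀ y : F, ∑ α ∈ c.det.support, localRingToFrac F 𝔪 (coeff α c.det) *
        algebraMap M F (Algebra.trace M F
          (y * localRingToFrac F 𝔪 (α.prod fun j n => P.coord j ^ n))) =
        localRingToFrac F 𝔪 P.jacobianDet * y := by
  have := finiteDimensional_of_isFractionRing B A M F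
  have : CharZero M := IsFractionRing.charZero_of_isFractionRing B
  obtain ⟨c, hc, hcJ⟩ := exists_eq_sum_mul_X_sub_C P.coord
    (fun i => map (algebraMap B (Localization.AtPrime 𝔪)) (P.f i)) fun i => by
      rw [eval_map, ← aeval_def, aeval_coord_f]
  refine ⟨Matrix.of c, hc, fun y => ?_⟩
  set c' : Matrix (Fin k) (Fin k) _ := Matrix.of c with hc'
  let ι : Localization.AtPrime 𝔪 →+* F := localRingToFrac F 𝔪
  have hι : Function.Injective ι := localRingToFrac_injective F 𝔪
  have hdet : (c'.map (map ι)).det = map ι c'.det := (RingHom.map_det _ _).symm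
  have hιB : ι.comp (algebraMap B _) = (algebraMap M F).comp (algebraMap B M) := by
    rw [← IsScalarTower.algebraMap_eq B M F]
    exact (localRingToFracOver F 𝔪 B).comp_algebraMap
  have key := trace_det_eq (P.adjoin_coord_eq_top M F)
    (f := fun i => map (algebraMap B M) (P.f i)) (fun i => by
      rw [aeval_map_algebraMap, aeval_localRingToFrac, aeval_coord_f, map_zero])
    (c := c'.map (map ι)) (fun i => by
      rw [map_map, ← hιB, ← map_map, hc i, map_sum]
      refine Finset.sum_congr rfl fun j _ => ?_
      rw [map_mul, map_sub, map_X, map_C]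
      rfl) y
  rw [hdet, support_map_of_injective _ hι] at key
  have hJ : eval (fun j => localRingToFrac F 𝔪 (P.coord j)) (map ι c'.det) =
      localRingToFrac F 𝔪 P.jacobianDet := by
    have h1 : eval (fun j => localRingToFrac F 𝔪 (P.coord j)) (map ι c'.det) =
        ι (eval P.coord c'.det) := by
      rw [eval_map]
      exact (eval₂_comp_left ι (RingHom.id _) P.coord c'.det).symm
    rw [h1, jacobianDet_eq, RingHom.map_det, AlgHom.map_det]
    have h2 : (eval P.coord).mapMatrix c' =
        (aeval P.coord).mapMatrix (Matrix.of fun i j => pderiv j (P.f i)) := by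
      ext1 i j
      refine (hcJ i j).trans ?_
      rw [pderiv_map, eval_map, ← aeval_def]
      rfl
    rw [h2]
    rfl
  rw [hJ] at key
  rw [← key]
  refine Finset.sum_congr rfl fun α _ => ?_
  rw [coeff_map, map_finsuppProd]
  simp only [map_pow]
  rfl

/-- The matrix of `exists_matrix_trace_formula` with a common denominator of the monomials that
occur in its determinant. -/
theorem exists_matrix_trace_formula_integral :
    ∃ (c : Matrix (Fin k) (Fin k) (MvPolynomial (Fin k) (Localization.AtPrime 𝔪))) (s : A)
      (a : (Fin k →₀ ℕ) → A), s ∉ 𝔪 ∧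
      (∀ i, map (algebraMap B _) (P.f i) = ∑ j, c i j * (X j - C (P.coord j))) ∧
      (∀ α ∈ c.det.support, algebraMap A (Localization.AtPrime 𝔪) (a α) =
        algebraMap A _ s * α.prod fun j n => P.coord j ^ n) ∧
      ∀ y : F, ∑ α ∈ c.det.support, localRingToFrac F 𝔪 (coeff α c.det) *
        algebraMap M F (Algebra.trace M F (y * algebraMap A F (a α))) =
        localRingToFrac F 𝔪 P.jacobianDet * (y * algebraMap A F s) := by
  obtain ⟨c, hc, hcJ⟩ := P.exists_matrix_trace_formula M F
  obtain ⟨s, hs⟩ := IsLocalization.exist_integer_multiples 𝔪.primeCompl c.det.support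
    fun α => α.prod fun j n => P.coord j ^ n
  have h : ∀ α, ∃ a : A, α ∈ c.det.support → algebraMap A (Localization.AtPrime 𝔪) a =
      algebraMap A _ s.1 * α.prod fun j n => P.coord j ^ n := fun α => by
    by_cases hα : α ∈ c.det.support
    · obtain ⟨a, ha⟩ := hs α hα
      exact ⟨a, fun _ => by rw [ha, Algebra.smul_def]⟩
    · exact ⟨0, fun h => absurd h hα⟩
  choose a ha using h
  refine ⟨c, s, a, s.2, hc, ha, fun y => ?_⟩
  rw [← hcJ]
  refine Finset.sum_congr rfl fun α hα => ?_
  rw [← (localRingToFrac F 𝔪).commutes (a α), ha α hα, map_mul (localRingToFrac F 𝔪),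
    AlgHom.commutes, mul_assoc]

variable {M F}

/-- The Jacobian determinant takes the codifferent into a fractional ideal `s⁻¹ A`, `s ∉ 𝔪`. -/
theorem exists_notMem_forall_mul_jacobianDet_mul :
    ∃ s ∉ 𝔪, ∀ y ∈ codifferent B A M F, ∃ a : A,
      algebraMap A F a = algebraMap A F s * (localRingToFrac F 𝔪 P.jacobianDet * y) := by
  obtain ⟨c, s, a, hs, -, -, hc⟩ := P.exists_matrix_trace_formula_integral M F
  obtain ⟨s', hs'⟩ := IsLocalization.exist_integer_multiples 𝔪.primeCompl c.det.support
    fun α => coeff α c.det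
  -- `s` puts the monomials into `A`, so their traces against `y` lie in `B`; `s'` clears the
  -- coefficients of `det c`. Neither depends on `y`.
  have hmul : s'.1 * s ∉ 𝔪 := 𝔪.primeCompl.mul_mem s'.2 hs
  refine ⟨s'.1 * s, hmul, fun y hy => ?_⟩
  choose β hβ using fun α => (mem_codifferent_iff y).mp hy (a α)
  have hsum : ∑ α ∈ c.det.support, (s'.1 • coeff α c.det) * algebraMap B _ (β α) ∈
      (algebraMap A (Localization.AtPrime 𝔪)).range := by
    refine sum_mem fun α hα => mul_mem (hs' α hα) ⟨algebraMap B A (β α), ?_⟩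
    rw [← IsScalarTower.algebraMap_apply]
  obtain ⟨x, hx⟩ := hsum
  refine ⟨x, ?_⟩
  rw [← (localRingToFrac F 𝔪).commutes, hx, map_mul, mul_assoc, mul_comm (algebraMap A F s),
    mul_assoc, ← hc, map_sum, Finset.mul_sum]
  refine Finset.sum_congr rfl fun α _ => ?_
  rw [map_mul, map_smul, Algebra.smul_def, ← hβ, mul_assoc]
  congr 2
  rw [← IsScalarTower.algebraMap_apply B M F]
  exact (localRingToFracOver F 𝔪 B).commutes _

/-- The Jacobian determinant takes the codifferent into the local ring. -/
theorem exists_eq_jacobianDet_mul {y : F} (hy : y ∈ codifferent B A M F) :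
    ∃ w, localRingToFrac F 𝔪 w = localRingToFrac F 𝔪 P.jacobianDet * y := by
  obtain ⟨s, hs, h⟩ := P.exists_notMem_forall_mul_jacobianDet_mul (M := M) (F := F)
  obtain ⟨a, ha⟩ := h y hy
  refine ⟨IsLocalization.mk' _ a (⟨s, hs⟩ : 𝔪.primeCompl), ?_⟩
  have hs0 : algebraMap A F s ≠ 0 := fun h0 => hs <| by
    rw [(map_eq_zero_iff _ (IsFractionRing.injective A F)).mp h0]
    exact 𝔪.zero_mem
  refine mul_left_cancel₀ hs0 ?_
  rw [← ha, ← (localRingToFrac F 𝔪).commutes, ← (localRingToFrac F 𝔪).commutes a, ← map_mul]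
  exact congr_arg _ (IsLocalization.mk'_spec' _ a (⟨s, hs⟩ : 𝔪.primeCompl))

/-- If `A` becomes free over `B` after inverting elements of `B` that do not vanish at a point
`ρ` of the local ring, then the image of the codifferent under the Jacobian determinant contains
an element that does not vanish at `ρ`. -/
theorem exists_mem_codifferent_of_basis {κ : Type*} [Field κ] (ρ : Localization.AtPrime 𝔪 →+* κ)
    {ι : Type*} [Finite ι] (b : Module.Basis ι M F) (e : ι → A)
    (he : ∀ i, b i = algebraMap A F (e i)) (t : B) (ht : ρ (algebraMap B _ t) ≠ 0)
    (hspan : ∀ a : A, t • a ∈ Submodule.span B (Set.range e)) :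
    ∃ y ∈ codifferent B A M F, ∃ w,
      localRingToFrac F 𝔪 w = localRingToFrac F 𝔪 P.jacobianDet * y ∧ ρ w ≠ 0 := by
  have := finiteDimensional_of_isFractionRing B A M F
  have : CharZero M := IsFractionRing.charZero_of_isFractionRing B
  have := Fintype.ofFinite ι
  classical
  by_contra! H
  obtain ⟨c, s, a, hs, hcX, has, hc⟩ := P.exists_matrix_trace_formula_integral M F
  have hBF : ∀ r : B, algebraMap M F (algebraMap B M r) =
      localRingToFrac F 𝔪 (algebraMap B _ r) := fun r => by
    rw [← IsScalarTower.algebraMap_apply B M F]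
    exact ((localRingToFracOver F 𝔪 B).commutes r).symm
  choose β hβ using fun a => (Submodule.mem_span_range_iff_exists_fun B).mp (hspan a)
  -- The coordinates of `t x` in the basis are its traces against the dual basis, so `t b_i*` lies
  -- in the codifferent.
  have hβtr : ∀ x i, Algebra.trace M F (algebraMap B F t * b.traceDual i * algebraMap A F x) =
      algebraMap B M (β x i) := fun x i => by
    have h1 : algebraMap B F t * b.traceDual i * algebraMap A F x =
        ∑ l, algebraMap B M (β x l) • (b.traceDual i * b l) := by
      rw [mul_right_comm, IsScalarTower.algebraMap_apply B A F, ← map_mul,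
        ← Algebra.smul_def t x, ← hβ, map_sum, Finset.sum_mul]
      refine Finset.sum_congr rfl fun l _ => ?_
      rw [he, Algebra.smul_def, map_mul, Algebra.smul_def, ← IsScalarTower.algebraMap_apply B A F,
        ← IsScalarTower.algebraMap_apply B M F]
      ring
    rw [h1, map_sum, Finset.sum_eq_single i]
    · rw [map_smul, b.trace_traceDual_mul, if_pos rfl, smul_eq_mul, mul_one]
    · intro l _ hl
      rw [map_smul, b.trace_traceDual_mul, if_neg hl, smul_zero]
    · simp
  have hmem : ∀ i, algebraMap B F t * b.traceDual i ∈ codifferent B A M F := fun i =>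
    (mem_codifferent_iff _).mpr fun x => ⟨_, (hβtr x i).symm⟩
  -- By the trace formula for `y = t b_i*` this sum is `s J y`, and `J y` vanishes at `ρ` by
  -- assumption.
  have hsum : ∀ i, ρ (∑ α ∈ c.det.support, coeff α c.det * algebraMap B _ (β (a α) i)) = 0 := by
    intro i
    obtain ⟨w, hw⟩ := P.exists_eq_jacobianDet_mul (hmem i)
    have h1 : ∑ α ∈ c.det.support, coeff α c.det * algebraMap B _ (β (a α) i) =
        w * algebraMap A _ s := by
      refine localRingToFrac_injective F 𝔪 ?_
      rw [map_mul, hw, AlgHom.commutes, mul_assoc, ← hc, map_sum]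
      refine Finset.sum_congr rfl fun α _ => ?_
      rw [map_mul, hβtr, hBF]
    rw [h1, map_mul, H _ (hmem i) w hw, zero_mul]
  obtain ⟨χ, hχB, hχ⟩ := P.exists_toFibre ρ
  have hst : IsUnit (χ (algebraMap B _ t) * χ (algebraMap A _ s)) := by
    refine IsUnit.mul ?_ ((IsLocalization.map_units (Localization.AtPrime 𝔪)
      (⟨s, hs⟩ : 𝔪.primeCompl)).map χ)
    rw [hχB]
    exact (IsUnit.mk0 _ ht).map _
  -- After multiplication by the unit `χ(t) χ(s)`, the class of `det c` is a combination of the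
  -- `χ(e_i)` whose coefficients are the sums in `hsum`.
  have hΔ : Ideal.Quotient.mk (Ideal.span (Set.range (P.eqn ρ))) (P.taylor ρ c.det) = 0 := by
    have h1 : Ideal.Quotient.mk (Ideal.span (Set.range (P.eqn ρ))) (P.taylor ρ c.det) =
        ∑ α ∈ c.det.support, algebraMap κ (P.Fibre ρ) (ρ (coeff α c.det)) *
          χ (α.prod fun j n => P.coord j ^ n) := by
      have h2 : (Ideal.Quotient.mk (Ideal.span (Set.range (P.eqn ρ)))).comp (P.taylor ρ) =
          eval₂Hom ((algebraMap κ (P.Fibre ρ)).comp ρ) fun j => χ (P.coord j) := by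
        refine ringHom_ext (fun x => ?_) fun j => ?_
        · simp [taylor]
          rfl
        · simp [taylor, hχ]
          rfl
      refine (RingHom.congr_fun h2 c.det).trans ?_
      rw [coe_eval₂Hom, eval₂_eq]
      refine Finset.sum_congr rfl fun α _ => ?_
      rw [map_finsuppProd]
      simp only [map_pow]
      rfl
    rw [h1, ← hst.mul_right_eq_zero, Finset.mul_sum]
    have h3 : ∀ α ∈ c.det.support, χ (algebraMap B _ t) * χ (algebraMap A _ s) *
        (algebraMap κ (P.Fibre ρ) (ρ (coeff α c.det)) * χ (α.prod fun j n => P.coord j ^ n)) =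
        ∑ i, algebraMap κ (P.Fibre ρ) (ρ (coeff α c.det * algebraMap B _ (β (a α) i))) *
          χ (algebraMap A _ (e i)) := fun α hα => by
      have h4 : χ (algebraMap B _ t) * (χ (algebraMap A _ s) *
          χ (α.prod fun j n => P.coord j ^ n)) = ∑ i, algebraMap κ (P.Fibre ρ)
            (ρ (algebraMap B _ (β (a α) i))) * χ (algebraMap A _ (e i)) := by
        rw [← map_mul χ (algebraMap A _ s), ← has α hα, ← map_mul,
          IsScalarTower.algebraMap_apply B A (Localization.AtPrime 𝔪), ← map_mul,
          ← Algebra.smul_def, ← hβ, map_sum, map_sum]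
        refine Finset.sum_congr rfl fun i _ => ?_
        rw [Algebra.smul_def, map_mul, map_mul,
          ← IsScalarTower.algebraMap_apply B A (Localization.AtPrime 𝔪), hχB]
      rw [mul_left_comm, ← mul_assoc, mul_assoc, mul_assoc, h4, Finset.mul_sum]
      refine Finset.sum_congr rfl fun i _ => ?_
      rw [map_mul, map_mul, mul_assoc]
    rw [Finset.sum_congr rfl h3, Finset.sum_comm]
    refine Finset.sum_eq_zero fun i _ => ?_
    rw [← Finset.sum_mul, ← map_sum, ← map_sum, hsum, map_zero, zero_mul]
  rw [Ideal.Quotient.eq_zero_iff_mem, RingHom.map_det] at hΔ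
  obtain ⟨m, hm⟩ := P.exists_X_pow_mem_span_eqn ρ
  refine MvPowerSeries.det_notMem_span_of_X_pow_mem (f := P.eqn ρ) ?_ hm hΔ
  ext1 i
  rw [eqn, hcX i, map_sum, Matrix.mulVec, dotProduct]
  refine Finset.sum_congr rfl fun j _ => ?_
  rw [map_mul, map_sub]
  congr 1
  simp [taylor]

end Trace

end LocalCIPresentation

/-! ### Freeness of `A` at the primes `(B : β)` -/

/-- A Noetherian local normal domain with an element `β ∉ R` of the fraction field such that `βz` is
integral for all nonunits `z` is a principal ideal ring. -/
theorem IsPrincipalIdealRing.of_forall_mul_mem {R K : Type*} [CommRing R] [IsDomain R]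
    [IsNoetherianRing R] [IsLocalRing R] [IsIntegrallyClosed R] [Field K] [Algebra R K]
    [IsFractionRing R K] {β : K} (hβ : β ∉ (algebraMap R K).range)
    (h : ∀ z ∈ IsLocalRing.maximalIdeal R, z • β ∈ (algebraMap R K).range) :
    IsPrincipalIdealRing R := by
  refine ((tfae_of_isNoetherianRing_of_isLocalRing_of_isDomain R).out 0 4).mpr ?_
  -- It suffices that the maximal ideal is principal. If `β` maps it into itself, it is zero or else
  -- `β` is integral; otherwise some `z β` is a unit and `z` generates it.
  by_cases H : ∀ z ∈ IsLocalRing.maximalIdeal R, ∀ u, algebraMap R K u = z • β →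
      u ∈ IsLocalRing.maximalIdeal R
  · by_cases hbot : IsLocalRing.maximalIdeal R = ⊥
    · rw [hbot]
      exact bot_isPrincipal
    exfalso
    refine hβ (IsIntegrallyClosed.isIntegral_iff.mp (isIntegral_of_smul_mem_submodule
      (Submodule.map (Algebra.linearMap R K) (IsLocalRing.maximalIdeal R)) ?_ ?_ β ?_))
    · rwa [Ne, ← Submodule.map_bot (Algebra.linearMap R K),
        (Submodule.map_injective_of_injective (f := Algebra.linearMap R K)
          (IsFractionRing.injective R K)).eq_iff]
    · exact (IsNoetherian.noetherian _).map _
    · rintro _ ⟨z, hz, rfl⟩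
      obtain ⟨u, hu⟩ := h z hz
      refine ⟨u, H z hz u hu, ?_⟩
      rw [Algebra.linearMap_apply, Algebra.linearMap_apply, hu, Algebra.smul_def, smul_eq_mul,
        mul_comm]
  · push Not at H
    obtain ⟨z, hz, u, hu, hum⟩ := H
    rw [IsLocalRing.mem_maximalIdeal, mem_nonunits_iff, not_not] at hum
    obtain ⟨u, rfl⟩ := hum
    refine ⟨z, le_antisymm (fun y hy => ?_) ((Ideal.span_singleton_le_iff_mem _).mpr hz)⟩
    obtain ⟨v, hv⟩ := h y hy
    refine Ideal.mem_span_singleton'.mpr ⟨↑u⁻¹ * v, ?_⟩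
    have h1 : u * y = v * z := by
      apply IsFractionRing.injective R K
      rw [map_mul, map_mul, hu, hv, Algebra.smul_def, Algebra.smul_def]
      ring
    rw [mul_assoc, ← h1, ← mul_assoc, Units.inv_mul, one_mul]

section Basis

variable {B A M F : Type*} [CommRing B] [IsDomain B] [CommRing A] [IsDomain A]
  [Algebra B A] [FaithfulSMul B A] [Module.Finite B A] [Field M] [Algebra B M] [IsFractionRing B M]
  [Field F] [Algebra A F] [IsFractionRing A F] [Algebra M F] [Algebra B F]
  [IsScalarTower B A F] [IsScalarTower B M F]

/-- If `B_𝔭` is a principal ideal ring, then `A` contains a basis of its fraction field that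
generates it at `𝔭`. -/
theorem exists_basis_of_isPrincipalIdealRing (𝔭 : Ideal B) [𝔭.IsPrime] (R : Type*) [CommRing R]
    [IsDomain R] [IsPrincipalIdealRing R] [Algebra B R] [IsLocalization.AtPrime R 𝔭] [Algebra R M]
    [Algebra R F] [IsScalarTower B R M] [IsScalarTower R M F] [IsFractionRing R M] :
    ∃ (n : ℕ) (b : Module.Basis (Fin n) M F) (e : Fin n → A) (t : B),
      (∀ i, b i = algebraMap A F (e i)) ∧ t ∉ 𝔭 ∧
      ∀ a : A, t • a ∈ Submodule.span B (Set.range e) := by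
  have : IsScalarTower B R F := IsScalarTower.of_algebraMap_eq fun x => by
    rw [IsScalarTower.algebraMap_apply R M F, ← IsScalarTower.algebraMap_apply B R M,
      ← IsScalarTower.algebraMap_apply B M F]
  have : FaithfulSMul R F := by
    rw [faithfulSMul_iff_algebraMap_injective, IsScalarTower.algebraMap_eq R M F]
    exact (algebraMap M F).injective.comp (IsFractionRing.injective R M)
  obtain ⟨G, hG⟩ := Module.finite_def.mp (inferInstance : Module.Finite B A)
  let incl : A →ₗ[B] F := (IsScalarTower.toAlgHom B A F).toLinearMap
  have hsm : ∀ (x : B) (a : A), algebraMap A F (x • a) = x • algebraMap A F a := incl.map_smul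
  -- The `R`-span of `A` in `F` is finite and torsion-free over a principal ideal domain, hence
  -- free. Scaling a basis by elements outside `𝔭` moves it into `A`.
  let N : Submodule R F := Submodule.span R (incl '' G)
  have hAN : ∀ a, algebraMap A F a ∈ N := fun a => by
    have ha : a ∈ Submodule.span B (G : Set A) := hG ▸ Submodule.mem_top
    have h1 := Submodule.mem_map_of_mem (f := incl) ha
    rw [Submodule.map_span] at h1
    exact Submodule.span_le_restrictScalars B R _ h1
  have hN : Module.Finite R N := Module.Finite.span_of_finite R (G.finite_toSet.image _)
  have hfree : Module.Free R N := Module.free_of_finite_type_torsion_free'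
  have hclear : ∀ y ∈ N, ∃ t ∉ 𝔭, ∃ a : A, t • y = algebraMap A F a := fun y hy => by
    induction hy using Submodule.span_induction with
    | mem y hy =>
      obtain ⟨a, -, rfl⟩ := hy
      exact ⟨1, 𝔭.primeCompl.one_mem, a, one_smul _ _⟩
    | zero => exact ⟨1, 𝔭.primeCompl.one_mem, 0, by simp⟩
    | add y z _ _ hy hz =>
      obtain ⟨t, ht, a, ha⟩ := hy
      obtain ⟨t', ht', a', ha'⟩ := hz
      refine ⟨t * t', 𝔭.primeCompl.mul_mem ht ht', t' • a + t • a', ?_⟩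
      rw [map_add, hsm, hsm, ← ha, ← ha', smul_add, mul_comm t, mul_smul,
        mul_comm t', mul_smul]
    | smul r y _ hy =>
      obtain ⟨t, ht, a, ha⟩ := hy
      obtain ⟨⟨x, s⟩, hs⟩ := IsLocalization.surj 𝔭.primeCompl r
      refine ⟨s * t, 𝔭.primeCompl.mul_mem s.2 ht, x • a, ?_⟩
      rw [hsm, ← ha, ← algebraMap_smul R x, ← hs, mul_smul, mul_comm, mul_smul,
        algebraMap_smul, smul_comm t r]
  let b₀ := Module.finBasis R N
  choose t ht e he using fun i => hclear (b₀ i) (b₀ i).2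
  have htu : ∀ i, IsUnit (algebraMap B R (t i)) := fun i =>
    IsLocalization.map_units R (⟨t i, ht i⟩ : 𝔭.primeCompl)
  let b₁ := b₀.isUnitSMul htu
  have hb₁ : ∀ i, (b₁ i : F) = algebraMap A F (e i) := fun i => by
    rw [Module.Basis.isUnitSMul_apply, Submodule.coe_smul, algebraMap_smul, he]
  have hN' : ∀ y ∈ N, ∃ z : Fin (Module.finrank R N) → R, y = ∑ i, z i • algebraMap A F (e i) :=
    fun y hy => by
      refine ⟨b₁.repr ⟨y, hy⟩, ?_⟩
      conv_lhs => rw [← Submodule.coe_mk (p := N) y hy, ← b₁.sum_repr ⟨y, hy⟩, Submodule.coe_sum]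
      exact Finset.sum_congr rfl fun i _ => by rw [Submodule.coe_smul, hb₁]
  have hli : LinearIndependent M fun i => algebraMap A F (e i) := by
    rw [← LinearIndependent.iff_fractionRing R M]
    have h1 : (fun i => algebraMap A F (e i)) = N.subtype ∘ b₁ := funext fun i => (hb₁ i).symm
    rw [h1]
    exact b₁.linearIndependent.map' N.subtype (Submodule.ker_subtype N)
  have hsp : ⊤ ≤ Submodule.span M (Set.range fun i => algebraMap A F (e i)) := by
    rintro y -
    obtain ⟨⟨a, ⟨_, t, ht0, rfl⟩⟩, hat⟩ :=
      IsLocalization.surj (Algebra.algebraMapSubmonoid A (nonZeroDivisors B)) y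
    have ht1 : algebraMap B M t ≠ 0 := IsFractionRing.to_map_ne_zero_of_mem_nonZeroDivisors ht0
    obtain ⟨z, hz⟩ := hN' _ (hAN a)
    have hy : y = (algebraMap B M t)⁻¹ • algebraMap A F a := by
      rw [eq_inv_smul_iff₀ ht1, ← hat, algebraMap_smul, Algebra.smul_def, mul_comm,
        ← IsScalarTower.algebraMap_apply B A F]
    rw [hy, hz]
    refine Submodule.smul_mem _ _ (Submodule.sum_mem _ fun i _ => ?_)
    rw [← algebraMap_smul M (z i)]
    exact Submodule.smul_mem _ _ (Submodule.subset_span ⟨i, rfl⟩)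
  have hcl : ∀ a : A, ∃ t ∉ 𝔭, t • a ∈ Submodule.span B (Set.range e) := fun a => by
    obtain ⟨z, hz⟩ := hN' _ (hAN a)
    obtain ⟨s, hs⟩ := IsLocalization.exist_integer_multiples 𝔭.primeCompl Finset.univ z
    choose β hβ using fun i => hs i (Finset.mem_univ i)
    refine ⟨s, s.2, (Submodule.mem_span_range_iff_exists_fun B).mpr ⟨β, ?_⟩⟩
    apply IsFractionRing.injective A F
    rw [map_sum, hsm, hz, Finset.smul_sum]
    refine Finset.sum_congr rfl fun i _ => ?_
    rw [hsm, ← algebraMap_smul R (β i), hβ, smul_assoc]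
  choose τ hτ hτspan using hcl
  refine ⟨_, Module.Basis.mk hli hsp, e, ∏ g ∈ G, τ g, fun i => by rw [Module.Basis.mk_apply],
    𝔭.primeCompl.prod_mem fun g _ => hτ g, fun a => ?_⟩
  have ha : a ∈ Submodule.span B (G : Set A) := hG ▸ Submodule.mem_top
  suffices h : Submodule.span B (G : Set A) ≤
      (Submodule.span B (Set.range e)).comap (LinearMap.lsmul B A (∏ g ∈ G, τ g)) from h ha
  rw [Submodule.span_le]
  intro g hg
  obtain ⟨c, hc⟩ := Finset.dvd_prod_of_mem τ hg
  rw [SetLike.mem_coe, Submodule.mem_comap, LinearMap.lsmul_apply, hc, mul_comm, mul_smul]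
  exact Submodule.smul_mem _ _ (hτspan g)

end Basis

/-- The contraction to `B` of a prime of the form `(ℭ : x)` is of the form `(B : β)`. -/
theorem exists_forall_mem_iff_of_eq_colon {B A M F : Type*} [CommRing B] [CommRing A] [Algebra B A]
    [Module.Finite B A] [Field M] [Algebra B M] [Field F] [Algebra A F]
    [Algebra M F] [Algebra B F] [IsScalarTower B A F] [IsScalarTower B M F] {q : Ideal A} [q.IsPrime] {x : F}
    (hq : q = (codifferent B A M F).colon {x}) :
    ∃ β : M, ∀ b : B, b ∈ q.comap (algebraMap B A) ↔ b • β ∈ (algebraMap B M).range := by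
  obtain ⟨G, hG⟩ := Module.finite_def.mp (inferInstance : Module.Finite B A)
  let I : A → Ideal B := fun a => (LinearMap.range (Algebra.linearMap B M)).colon
    {Algebra.trace M F (x * algebraMap A F a)}
  have hI : ∀ a b, b ∈ I a ↔
      b • Algebra.trace M F (x * algebraMap A F a) ∈ (algebraMap B M).range :=
    fun a b => Submodule.mem_colon_singleton
  have htr : ∀ (b : B) (y : F), Algebra.trace M F (b • y) = b • Algebra.trace M F y :=
    fun b y => by rw [← algebraMap_smul M b, map_smul, algebraMap_smul]
  have hmem : ∀ b : B, b ∈ q.comap (algebraMap B A) ↔ ∀ a, b ∈ I a := fun b => by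
    rw [Ideal.mem_comap, hq, Submodule.mem_colon_singleton, mem_codifferent_iff]
    refine forall_congr' fun a => ?_
    rw [hI, ← htr, algebraMap_smul, smul_mul_assoc]
  have hG' : ∀ b : B, (∀ g ∈ G, b ∈ I g) → ∀ a, b ∈ I a := fun b hb a => by
    have ha : a ∈ Submodule.span B (G : Set A) := hG ▸ Submodule.mem_top
    rw [hI]
    induction ha using Submodule.span_induction with
    | mem a ha => exact (hI a b).mp (hb a ha)
    | zero => simp
    | add a a' _ _ ha ha' =>
      rw [map_add, mul_add, map_add, smul_add]
      exact add_mem ha ha'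
    | smul r a _ ha =>
      have h1 : x * algebraMap A F (r • a) = r • (x * algebraMap A F a) := by
        rw [Algebra.smul_def, map_mul, ← IsScalarTower.algebraMap_apply B A F, Algebra.smul_def,
          mul_left_comm]
      rw [h1, htr, smul_comm, Algebra.smul_def]
      exact mul_mem ⟨r, rfl⟩ ha
  -- The contraction is the intersection of the ideals `(B : Tr(xg))` over finitely many generators
  -- `g`; being prime, it equals one of them.
  have hinf : G.inf I ≤ q.comap (algebraMap B A) := fun b hb =>
    (hmem b).mpr (hG' b fun g hg => (Finset.inf_le hg : G.inf I ≤ I g) hb)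
  obtain ⟨g, -, hg⟩ := (Ideal.IsPrime.inf_le' (Ideal.comap_isPrime _ q)).mp hinf
  exact ⟨_, fun b => ⟨fun hb => (hI g b).mp ((hmem b).mp hb g), fun hb => hg ((hI g b).mpr hb)⟩⟩

/-! ### The codifferent at a prime and its invertibility -/

section Codifferent

variable {B A M F : Type*}
  [CommRing B] [IsDomain B] [IsNoetherianRing B] [IsIntegrallyClosed B]
  [CommRing A] [IsDomain A] [Algebra B A] [FaithfulSMul B A] [Module.Finite B A]
  [Field M] [Algebra B M] [IsFractionRing B M] [Field F] [Algebra A F] [IsFractionRing A F]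
  [Algebra M F] [Algebra B F] [IsScalarTower B A F] [IsScalarTower B M F]

/-- `A` is free over `B` at the primes of the form `(B : β)`. -/
theorem exists_basis_of_forall_mem_iff (𝔭 : Ideal B) [𝔭.IsPrime] {β : M}
    (hβ : ∀ b : B, b ∈ 𝔭 ↔ b • β ∈ (algebraMap B M).range) :
    ∃ (n : ℕ) (b : Module.Basis (Fin n) M F) (e : Fin n → A) (t : B),
      (∀ i, b i = algebraMap A F (e i)) ∧ t ∉ 𝔭 ∧
      ∀ a : A, t • a ∈ Submodule.span B (Set.range e) := by
  let R := Localization.AtPrime 𝔭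
  let _ : Algebra R M := (localRingToFrac M 𝔭).toRingHom.toAlgebra
  let _ : Algebra R F := ((algebraMap M F).comp (algebraMap R M)).toAlgebra
  have : IsScalarTower B R M :=
    IsScalarTower.of_algebraMap_eq fun x => ((localRingToFrac M 𝔭).commutes x).symm
  have : IsScalarTower R M F := IsScalarTower.of_algebraMap_eq fun _ => rfl
  have : IsFractionRing R M :=
    IsFractionRing.isFractionRing_of_isDomain_of_isLocalization 𝔭.primeCompl R M
  have : IsIntegrallyClosed R :=
    isIntegrallyClosed_of_isLocalization R 𝔭.primeCompl 𝔭.primeCompl_le_nonZeroDivisors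
  have hmk : ∀ (b : B) (s : 𝔭.primeCompl), algebraMap R M (IsLocalization.mk' R b s) *
      algebraMap B M s = algebraMap B M b := fun b s => by
    rw [IsScalarTower.algebraMap_apply B R M, IsScalarTower.algebraMap_apply B R M, ← map_mul,
      IsLocalization.mk'_spec]
  have hs0 : ∀ s : 𝔭.primeCompl, algebraMap B M s ≠ 0 := fun s =>
    IsFractionRing.to_map_ne_zero_of_mem_nonZeroDivisors (𝔭.primeCompl_le_nonZeroDivisors s.2)
  have : IsPrincipalIdealRing R := by
    refine IsPrincipalIdealRing.of_forall_mul_mem (K := M) (β := β) ?_ ?_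
    · rintro ⟨z, rfl⟩
      obtain ⟨b, s, rfl⟩ := IsLocalization.exists_mk'_eq 𝔭.primeCompl z
      refine s.2 ((hβ s).mpr ⟨b, ?_⟩)
      rw [Algebra.smul_def, mul_comm, hmk]
    · intro z hz
      obtain ⟨b, s, rfl⟩ := IsLocalization.exists_mk'_eq 𝔭.primeCompl z
      obtain ⟨c, hc⟩ := (hβ b).mp ((IsLocalization.AtPrime.mk'_mem_maximal_iff R 𝔭 b s).mp hz)
      refine ⟨IsLocalization.mk' R c s, mul_right_cancel₀ (hs0 s) ?_⟩
      rw [hmk, hc, Algebra.smul_def, Algebra.smul_def, mul_right_comm, hmk]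
  exact exists_basis_of_isPrincipalIdealRing 𝔭 R

variable [CharZero B]

/-- Only minimal primes of the colon ideal `(ℭ : J⁻¹)` have to be tested, and `A` is free over `B`
at their contractions. This replaces freeness at `𝔪` itself. -/
theorem LocalCIPresentation.exists_smul_inv_jacobianDet_mem {𝔪 : Ideal A} [𝔪.IsPrime] {k : ℕ}
    (P : LocalCIPresentation B 𝔪 k k) :
    ∃ t ∉ 𝔪, t • (localRingToFrac F 𝔪 P.jacobianDet)⁻¹ ∈ codifferent B A M F := by
  have hJ := P.jacobianDet_ne_zero M F
  set J := localRingToFrac F 𝔪 P.jacobianDet with hJdef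
  by_contra! H
  have : IsNoetherianRing A := IsNoetherianRing.of_finite B A
  have hle : (codifferent B A M F).colon {J⁻¹} ≤ 𝔪 := fun t ht => by
    by_contra htm
    exact H t htm (Submodule.mem_colon_singleton.mp ht)
  obtain ⟨q, hqmin, hqm⟩ := Ideal.exists_minimalPrimes_le hle
  have hq : q.IsPrime := hqmin.isPrime
  obtain ⟨x, hx⟩ := Submodule.exists_eq_colon_of_mem_minimalPrimes hqmin
  obtain ⟨β, hβ⟩ := exists_forall_mem_iff_of_eq_colon hx
  obtain ⟨n, b, e, t, he, ht, hspan⟩ :=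
    exists_basis_of_forall_mem_iff (A := A) (F := F) (q.comap (algebraMap B A)) hβ
  -- As `q ⊆ 𝔪`, the residue field of `q` is a point of `A_𝔪`, in general not the closed one.
  let ρ : Localization.AtPrime 𝔪 →+* q.ResidueField :=
    IsLocalization.lift (M := 𝔪.primeCompl) (g := algebraMap A q.ResidueField) fun s =>
      IsUnit.mk0 _ fun h => s.2 (hqm (Ideal.algebraMap_residueField_eq_zero.mp h))
  have hρ : ∀ a, ρ (algebraMap A _ a) = algebraMap A q.ResidueField a := fun a =>
    IsLocalization.lift_eq _ a
  obtain ⟨y, hy, w, hw, hρw⟩ := P.exists_mem_codifferent_of_basis ρ b e he t (by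
    rw [IsScalarTower.algebraMap_apply B A (Localization.AtPrime 𝔪), hρ]
    exact fun h => ht (Ideal.mem_comap.mpr (Ideal.algebraMap_residueField_eq_zero.mp h))) hspan
  obtain ⟨⟨a, s⟩, has⟩ := IsLocalization.surj 𝔪.primeCompl w
  have haq : a ∉ q := fun h => by
    have h1 : ρ w * ρ (algebraMap A _ s.1) = 0 := by
      rw [← map_mul, has, hρ]
      exact Ideal.algebraMap_residueField_eq_zero.mpr h
    refine (mul_ne_zero hρw ?_) h1
    rw [hρ]
    exact fun h => s.2 (hqm (Ideal.algebraMap_residueField_eq_zero.mp h))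
  -- From `J y = a / s` follows `a J⁻¹ = s y ∈ ℭ`, so `a` lies in the colon ideal and hence in `q`.
  refine haq (hqmin.1.2 (Submodule.mem_colon_singleton.mpr ?_))
  have h1 := congr_arg (localRingToFrac F 𝔪) has
  rw [map_mul, hw, AlgHom.commutes, AlgHom.commutes, ← hJdef] at h1
  have h2 : a • J⁻¹ = s.1 • y := by
    rw [Algebra.smul_def, ← h1, Algebra.smul_def]
    field_simp
  rw [h2]
  exact Submodule.smul_mem _ _ hy

theorem LocalCIPresentation.span_codifferent_eq {𝔪 : Ideal A} [𝔪.IsPrime] {k : ℕ}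
    (P : LocalCIPresentation B 𝔪 k k) :
    Submodule.span (localRingToFrac F 𝔪).range (codifferent B A M F : Set F) =
      Submodule.span (localRingToFrac F 𝔪).range {(localRingToFrac F 𝔪 P.jacobianDet)⁻¹} := by
  have hJ := P.jacobianDet_ne_zero M F
  apply le_antisymm
  · rw [Submodule.span_le]
    intro y hy
    obtain ⟨w, hw⟩ := P.exists_eq_jacobianDet_mul hy
    refine Submodule.mem_span_singleton.mpr ⟨⟨localRingToFrac F 𝔪 w, w, rfl⟩, ?_⟩
    change localRingToFrac F 𝔪 w * _ = y
    rw [hw, mul_right_comm, mul_inv_cancel₀ hJ, one_mul]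
  · rw [Submodule.span_singleton_le_iff_mem]
    obtain ⟨t, ht, h⟩ := P.exists_smul_inv_jacobianDet_mem (M := M) (F := F)
    obtain ⟨u, hu⟩ := IsLocalization.map_units (Localization.AtPrime 𝔪) (⟨t, ht⟩ : 𝔪.primeCompl)
    have h1 : (localRingToFrac F 𝔪 P.jacobianDet)⁻¹ =
        (⟨localRingToFrac F 𝔪 ↑u⁻¹, _, rfl⟩ : (localRingToFrac F 𝔪).range) •
          (t • (localRingToFrac F 𝔪 P.jacobianDet)⁻¹) := by
      change _ = localRingToFrac F 𝔪 ↑u⁻¹ * _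
      rw [Algebra.smul_def, ← (localRingToFrac F 𝔪).commutes t, ← mul_assoc, ← map_mul]
      change _ = localRingToFrac F 𝔪 (↑u⁻¹ * algebraMap A _ (⟨t, ht⟩ : 𝔪.primeCompl).1) * _
      rw [← hu, Units.inv_mul, map_one, one_mul]
    rw [h1]
    exact Submodule.smul_mem _ _ (Submodule.subset_span h)

/-- At each `𝔪` there are `t, s ∉ 𝔪` with `t J⁻¹ ∈ ℭ` and `s J ∈ (A : ℭ)`; the latter requires an
`s` that works for all of `ℭ`. So `t s ∈ ℭ (A : ℭ)`, and this ideal lies in no maximal ideal. -/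
theorem isUnit_codifferent
    (h : ∀ (𝔪 : Ideal A) [𝔪.IsMaximal], ∃ k, Nonempty (LocalCIPresentation B 𝔪 k k)) :
    IsUnit (codifferent B A M F) := by
  refine IsUnit.of_mul_eq_one (1 / codifferent B A M F) (le_antisymm Submodule.mul_one_div_le_one ?_)
  rw [Submodule.one_le]
  by_contra hone
  let I : Ideal A := (codifferent B A M F * (1 / codifferent B A M F)).comap (Algebra.linearMap A F)
  have hI : I ≠ ⊤ := fun h => hone <| by
    have h1 : (1 : A) ∈ I := h ▸ Submodule.mem_top
    simpa [I] using h1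
  obtain ⟨𝔪, h𝔪, hIm⟩ := Ideal.exists_le_maximal I hI
  obtain ⟨k, ⟨P⟩⟩ := h 𝔪
  have hJ := P.jacobianDet_ne_zero M F
  obtain ⟨t, ht, htmem⟩ := P.exists_smul_inv_jacobianDet_mem (M := M) (F := F)
  obtain ⟨s, hs, hsmem⟩ := P.exists_notMem_forall_mul_jacobianDet_mul (M := M) (F := F)
  refine 𝔪.primeCompl.mul_mem ht hs (hIm ?_)
  have h2 : algebraMap A F (t * s) = (t • (localRingToFrac F 𝔪 P.jacobianDet)⁻¹) *
      (algebraMap A F s * localRingToFrac F 𝔪 P.jacobianDet) := by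
    rw [Algebra.smul_def, map_mul]
    field_simp
  rw [Submodule.mem_comap, Algebra.linearMap_apply, h2]
  refine Submodule.mul_mem_mul htmem (Submodule.mem_div_iff_forall_mul_mem.mpr fun y hy => ?_)
  obtain ⟨a, ha⟩ := hsmem y hy
  rw [mul_assoc, ← ha]
  exact Submodule.mem_one.mpr ⟨a, rfl⟩

end Codifferent

theorem mainTheorem8 {B A M F : Type*}
    [CommRing B] [IsDomain B] [IsNoetherianRing B] [IsIntegrallyClosed B] [CharZero B]
    [CommRing A] [IsDomain A] [IsIntegrallyClosed A]
    [Algebra B A] [FaithfulSMul B A] [Module.Finite B A]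
    [Field M] [Algebra B M] [IsFractionRing B M]
    [Field F] [Algebra A F] [IsFractionRing A F]
    [Algebra M F] [Algebra B F] [IsScalarTower B A F] [IsScalarTower B M F]
    (hAB : IsLocalCompleteIntersection B A) :
    Module.Invertible A (codifferent B A M F) ∧
      ∀ (𝔪 : Ideal A) [𝔪.IsMaximal],
        (∃ k : ℕ, Nonempty (LocalCIPresentation B 𝔪 k k)) ∧
        ∀ (k : ℕ) (P : LocalCIPresentation B 𝔪 k k),
          localRingToFrac F 𝔪 P.jacobianDet ≠ 0 ∧
          Submodule.span (localRingToFrac F 𝔪).range (codifferent B A M F : Set F) =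
            Submodule.span (localRingToFrac F 𝔪).range
              {(localRingToFrac F 𝔪 P.jacobianDet)⁻¹} := by
  have hex : ∀ (𝔪 : Ideal A) [𝔪.IsMaximal], ∃ k, Nonempty (LocalCIPresentation B 𝔪 k k) :=
    fun 𝔪 _ => by
      obtain ⟨k, r, ⟨P⟩⟩ := hAB 𝔪
      obtain rfl : k = r := le_antisymm (P.card_vars_le M F) (P.card_eqs_le M F)
      exact ⟨k, ⟨P⟩⟩
  refine ⟨?_, fun 𝔪 _ => ⟨hex 𝔪, fun k P => ⟨P.jacobianDet_ne_zero M F, P.span_codifferent_eq⟩⟩⟩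
  obtain ⟨u, hu⟩ := isUnit_codifferent (M := M) (F := F) hex
  rw [← hu]
  infer_instance
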